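/- **Setting.** Let $\mathbb H^4=\{x\in\mathbb R^5: x_1^2+x_2^2+x_3^2+x_4^2-x_5^2=-1,\ x_5>0\}$ with the Lorentzian inner product $\langle\cdot,\cdot\rangle$. The regular ideal 24-cell in $\mathbb H^4$ with ideal vertices $(\pm1,0,0,0),\dots,(0,0,0,\pm1),(\pm\tfrac12,\pm\tfrac12,\pm\tfrac12,\pm\tfrac12)$ has the 24 sides with normal vectors $v=\pm e_a\pm e_b+e_5$, $1\le a<b\le4$; let $r_v(x)=x-2\langle x,v\rangle v$ be the reflection in such a side. A code $k_{12}k_{13}k_{23}k_{14}k_{24}k_{34}$ of six hexadecimal digits assigns to the four sides $\pm e_a\pm e_b+e_5$ the diagonal matrix, also written $k_{ab}$, which changes the sign of $x_m$ ($1\le m\le 4$) exactly if the binary digit $2^{m-1}$ occurs in $k_{ab}$, and fixes $x_5$. Let $G$ be the group generated by the 24 side-pairing isometries $r_vk_{ab}$, and $N=\mathbb H^4/G$. The integral congruence two hyperbolic 4-manifolds $N_{23},N_{71},N_{1091},N_{1092}$ are the manifolds $N$ obtained in this way from the codes $\mathtt{1569A4}$, $\mathtt{13EB34}$, $\mathtt{53FF35}$,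 $\mathtt{53FFCA}$, respectively. For $j\in\{1,2,3,4\}$ the $j$-th cross-section of $N$ is the image in $N$ of the coordinate hyperplane $\{x\in\mathbb H^4:x_j=0\}$; it is a totally geodesic hyperbolic 3-manifold. For an ideal $(a)$ of $\mathbb Z[i]$ let $\Gamma(a)\le\mathrm{PSL}(2,\mathbb Z[i])$ be the principal congruence subgroup, consisting of the classes of the matrices in $\mathrm{SL}(2,\mathbb Z[i])$ congruent to the identity modulo $(a)$. **Proposition.** Let $Y$ be any non-orientable cross-section of one of $N_{23},N_{71},N_{1091},N_{1092}$, and let $Y^+$ be its orientable double cover. Then, for any base point, there is an injective homomorphism $\pi_1(Y^+)\to\mathrm{PSL}(2,\mathbb Z[i])$ whose image $\Gamma$ has index $48$ in $\mathrm{PSL}(2,\mathbb Z[i])$ and satisfies $$[\Gamma(1+i),\Gamma(1+i)]\ \triangleleft\ \Gamma\ \triangleleft\ \Gamma(1+i).$$ -/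

import Mathlib

open scoped Matrix commutatorElement

namespace CongruenceTwo

/-! ### Hyperbolic four-space and integral isometries -/

/-- The Lorentzian inner product on `ℝ⁵`; the last coordinate is the time coordinate. -/
def lorentz (x y : Fin 5 → ℝ) : ℝ :=
  (∑ i : Fin 4, x i.castSucc * y i.castSucc) - x 4 * y 4

/-- Hyperbolic four-space: the upper sheet of the hyperboloid, with the topology induced
from `ℝ⁵`. -/
abbrev HypFour : Type := {x : Fin 5 → ℝ // lorentz x x = -1 ∧ 0 < x 4}

/-- The linear action of an integral matrix on `ℝ⁵`. -/
def act (g : GL (Fin 5) ℤ) (x : Fin 5 → ℝ) : Fin 5 → ℝ :=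
  (g : Matrix (Fin 5) (Fin 5) ℤ).map (Int.cast : ℤ → ℝ) *ᵥ x

/-! ### The four side-pairings of the ideal 24-cell -/

/-- The matrix of the Lorentzian reflection `x ↦ x - 2 ⟨x, v⟩ v` in the hyperplane orthogonal
to a vector `v` with `⟨v, v⟩ = 1`. -/
def reflection (v : Fin 5 → ℤ) : Matrix (Fin 5) (Fin 5) ℤ :=
  Matrix.of fun a b => (if a = b then 1 else 0) - 2 * v a * (if b = 4 then -v b else v b)

/-- The six pairs of space coordinates, in the order in which the codes list them.  The two
coordinates of the pair `p` are `(pairs p).1` and `(pairs p).2`. -/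
def pairs : Fin 6 → Fin 5 × Fin 5 :=
  ![(0, 1), (0, 2), (1, 2), (0, 3), (1, 3), (2, 3)]

/-- The normal vector `s e_a + t e_b + e_4` of a side of the 24-cell, where `{a, b}` is the
pair `p` and `s, t = ±1`.  The regular ideal 24-cell with ideal vertices
`(±1,0,0,0), …, (0,0,0,±1), (±1/2,±1/2,±1/2,±1/2)` is the set of all `x` in hyperbolic
four-space with `⟨x, sideNormal p s t⟩ ≤ 0` for all `24` choices of `p, s, t`. -/
def sideNormal (p : Fin 6) (s t : ℤˣ) : Fin 5 → ℤ := fun a =>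
  if a = (pairs p).1 then (s : ℤ) else if a = (pairs p).2 then (t : ℤ)
  else if a = 4 then 1 else 0

/-- The four manifolds, by their numbers in the census of integral congruence two hyperbolic
four-manifolds. -/
inductive Census : Type
  | N23 | N71 | N1091 | N1092

/-- The side-pairing codes `1569A4`, `13EB34`, `53FF35`, `53FFCA`: one hexadecimal digit for each
pair of coordinates, that is, for each block of four sides. -/
def code : Census → Fin 6 → ℕ
  | .N23 => ![1, 5, 6, 9, 10, 4]
  | .N71 => ![1, 3, 14, 11, 3, 4]
  | .N1091 => ![5, 3, 15, 15, 3, 5]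
  | .N1092 => ![5, 3, 15, 15, 12, 10]

/-- The diagonal matrix of a digit `k`: it changes the sign of the `m`-th coordinate
exactly if the `m`-th binary digit of `k` is `1`. -/
def signMatrix (k : ℕ) : Matrix (Fin 5) (Fin 5) ℤ :=
  Matrix.diagonal fun m => if k.testBit (m : ℕ) then -1 else 1

/-- The group of integral Lorentzian isometries generated by the side-pairing isometries `r k`,
where `r` is the reflection in a side of the 24-cell and `k` is the diagonal matrix which the
code attaches to this side. -/
def sidePairingGroup (c : Census) : Subgroup (GL (Fin 5) ℤ) :=
  Subgroup.closure {g | ∃ (p : Fin 6) (s t : ℤˣ),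
    (g : Matrix (Fin 5) (Fin 5) ℤ) = reflection (sideNormal p s t) * signMatrix (code c p)}

theorem act_one (x : Fin 5 → ℝ) : act 1 x = x := by
  simp [act]

theorem act_mul (g h : GL (Fin 5) ℤ) (x : Fin 5 → ℝ) : act (g * h) x = act g (act h x) := by
  have hm : ((g * h : GL (Fin 5) ℤ) : Matrix (Fin 5) (Fin 5) ℤ).map (Int.cast : ℤ → ℝ)
      = (g : Matrix (Fin 5) (Fin 5) ℤ).map (Int.cast : ℤ → ℝ)
        * (h : Matrix (Fin 5) (Fin 5) ℤ).map (Int.cast : ℤ → ℝ) := by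
    rw [Units.val_mul]
    exact Matrix.map_mul (f := Int.castRingHom ℝ)
  simp only [act, hm, Matrix.mulVec_mulVec]

theorem act_inv_act (g : GL (Fin 5) ℤ) (x : Fin 5 → ℝ) : act g⁻¹ (act g x) = x := by
  rw [← act_mul, inv_mul_cancel, act_one]

/-- Two points of hyperbolic four-space are identified if an element of the side-pairing group
takes one to the other. -/
def orbitSetoid (c : Census) : Setoid HypFour where
  r x y := ∃ g ∈ sidePairingGroup c, act g x.1 = y.1
  iseqv :=
    { refl := fun x => ⟨1, one_mem _, act_one _⟩
      symm := by
        rintro x y ⟨g, hg, h⟩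
        exact ⟨g⁻¹, inv_mem hg, by rw [← h, act_inv_act]⟩
      trans := by
        rintro x y z ⟨g, hg, h⟩ ⟨g', hg', h'⟩
        exact ⟨g' * g, mul_mem hg' hg, by rw [act_mul, h, h']⟩ }

/-- The hyperbolic four-manifold of the side-pairing: the quotient of hyperbolic four-space by
the side-pairing group, with the quotient topology. -/
abbrev FourManifold (c : Census) : Type := Quotient (orbitSetoid c)

/-! ### Cross-sections and their orientation double covers -/

/-- The `j`-th coordinate hyperplane of hyperbolic four-space, a copy of hyperbolic
three-space. -/
abbrev Hyperplane (j : Fin 4) : Type := {x : HypFour // x.1 j.castSucc = 0}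

/-- The `j`-th cross-section: the image in the four-manifold of the `j`-th
coordinate hyperplane, with the subspace topology. -/
def crossSection (c : Census) (j : Fin 4) : Set (FourManifold c) :=
  {y | ∃ x : Hyperplane j, Quotient.mk (orbitSetoid c) x.1 = y}

/-- `g` maps the `j`-th coordinate hyperplane onto itself. -/
def PreservesHyperplane (j : Fin 4) (g : GL (Fin 5) ℤ) : Prop :=
  ∀ z : Fin 5 → ℝ, act g z j.castSucc = 0 ↔ z j.castSucc = 0

/-- The determinant of the restriction to the `j`-th coordinate hyperplane of a matrix `g` that
preserves this hyperplane.  For an isometry of hyperbolic four-space it is `1` or `-1`, according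
to whether `g` preserves or reverses the orientation of the hyperplane. -/
def hyperplaneDet (j : Fin 4) (g : GL (Fin 5) ℤ) : ℤ :=
  ((g : Matrix (Fin 5) (Fin 5) ℤ).submatrix j.castSucc.succAbove j.castSucc.succAbove).det

theorem PreservesHyperplane.one (j : Fin 4) : PreservesHyperplane j 1 := by
  intro z
  rw [act_one]

theorem PreservesHyperplane.mul {j : Fin 4} {g h : GL (Fin 5) ℤ}
    (hg : PreservesHyperplane j g) (hh : PreservesHyperplane j h) :
    PreservesHyperplane j (g * h) := by
  intro z
  rw [act_mul, hg, hh]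

theorem PreservesHyperplane.inv {j : Fin 4} {g : GL (Fin 5) ℤ}
    (hg : PreservesHyperplane j g) : PreservesHyperplane j g⁻¹ := by
  intro z
  rw [← hg (act g⁻¹ z), ← act_mul, mul_inv_cancel, act_one]

theorem PreservesHyperplane.apply_eq_zero {j : Fin 4} {g : GL (Fin 5) ℤ}
    (hg : PreservesHyperplane j g) {i : Fin 5} (hi : i ≠ j.castSucc) :
    (g : Matrix (Fin 5) (Fin 5) ℤ) j.castSucc i = 0 := by
  have h := (hg (Pi.single i 1)).2 (Pi.single_eq_of_ne hi.symm 1)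
  simpa [act] using h

theorem hyperplaneDet_one (j : Fin 4) : hyperplaneDet j 1 = 1 := by
  simp [hyperplaneDet, Matrix.submatrix_one _ j.castSucc.succAbove_right_injective]

theorem hyperplaneDet_mul {j : Fin 4} (g : GL (Fin 5) ℤ) {h : GL (Fin 5) ℤ}
    (hh : PreservesHyperplane j h) :
    hyperplaneDet j (g * h) = hyperplaneDet j g * hyperplaneDet j h := by
  rw [hyperplaneDet, hyperplaneDet, hyperplaneDet, ← Matrix.det_mul]
  congr 1
  ext a b
  rw [Matrix.submatrix_apply, Units.val_mul, Matrix.mul_apply, Matrix.mul_apply,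
    Fin.sum_univ_succAbove _ j.castSucc, hh.apply_eq_zero (Fin.succAbove_ne _ _)]
  simp

/-- Points of the orientation double cover are represented by pairs `(x, o)` of a point `x` of
the coordinate hyperplane and one of its two orientations `o = ±1` (with respect to
the standard one).  Two pairs are identified if an element of the side-pairing group that preserves
the hyperplane takes one pair to the other. -/
def orientationSetoid (c : Census) (j : Fin 4) : Setoid (Hyperplane j × ℤˣ) where
  r p q := ∃ g ∈ sidePairingGroup c, PreservesHyperplane j g ∧
    act g p.1.1.1 = q.1.1.1 ∧ hyperplaneDet j g * (p.2 : ℤ) = (q.2 : ℤ)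
  iseqv :=
    { refl := fun p => ⟨1, one_mem _, .one j, act_one _, by rw [hyperplaneDet_one, one_mul]⟩
      symm := by
        rintro p q ⟨g, hg, hp, h, ho⟩
        refine ⟨g⁻¹, inv_mem hg, hp.inv, by rw [← h, act_inv_act], ?_⟩
        rw [← ho, ← mul_assoc, ← hyperplaneDet_mul _ hp, inv_mul_cancel, hyperplaneDet_one,
          one_mul]
      trans := by
        rintro p q r ⟨g, hg, hp, h, ho⟩ ⟨g', hg', hp', h', ho'⟩
        refine ⟨g' * g, mul_mem hg' hg, hp'.mul hp, by rw [act_mul, h, h'], ?_⟩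
        rw [hyperplaneDet_mul _ hp, mul_assoc, ho, ho'] }

/-- The orientation double cover of the `j`-th cross-section: the space of pairs of a point of the
cross-section and a local orientation there, with the quotient topology (the two-point
set `ℤˣ` of signs is discrete). -/
abbrev OrientationCover (c : Census) (j : Fin 4) : Type := Quotient (orientationSetoid c j)

/-- The covering map, which forgets the local orientation. -/
def coverMap (c : Census) (j : Fin 4) : OrientationCover c j → crossSection c j :=
  Quotient.lift (fun p => ⟨Quotient.mk (orbitSetoid c) p.1.1, p.1, rfl⟩) (by
    rintro p q ⟨g, hg, -, h, -⟩
    exact Subtype.ext (Quotient.sound ⟨g, hg, h⟩))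

/-- A cross-section is orientable if one can choose local orientations continuously, that is, if
its orientation double cover has a continuous section. -/
def CrossSectionOrientable (c : Census) (j : Fin 4) : Prop :=
  ∃ s : crossSection c j → OrientationCover c j, Continuous s ∧ ∀ y, coverMap c j (s y) = y

/-! ### The Picard group -/

/-- The Picard group `PSL(2, ℤ[i])`. -/
abbrev Picard : Type := Matrix.ProjectiveSpecialLinearGroup (Fin 2) GaussianInt

/-- The principal congruence subgroup `Γ(a)` of the Picard group: the classes of the matrices
that are congruent to the identity modulo the ideal `(a)`. -/
def principalCongruence (a : GaussianInt) : Subgroup Picard :=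
  Subgroup.map (QuotientGroup.mk' (Subgroup.center (Matrix.SpecialLinearGroup (Fin 2) GaussianInt)))
    (Matrix.SpecialLinearGroup.map (n := Fin 2) (Ideal.Quotient.mk (Ideal.span {a}))).ker

end CongruenceTwo

namespace CongruenceTwo

/-! ### Integral Lorentzian matrices congruent to the identity modulo two -/

/-! The proof compares two discrete groups acting on hyperbolic three-space with `lorentzTwo 3`, the
integral isometries congruent to the identity modulo two. By a descent on the time coordinate
(`lorentzTwo_induction`) this group is generated by six reflections.

Writing `g = 1 - 2 A` and reducing `A` modulo two turns products into sums (`half_mul`). A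
side-pairing code therefore defines a homomorphism `holonomy` to `(ℤ/2)⁴` that kills every
side-pairing isometry. Restricted to the `j`-th hyperplane, where the sign of the `j`-th coordinate
is invisible, it becomes `crossHom : lorentzTwo 3 → (ℤ/2)³`. The stabiliser of the hyperplane in the
side-pairing group restricts exactly to the kernel: `exists_restriction` gives one inclusion, and
`exists_mem_sidePairingGroup` gives the other, since every isometry of the hyperplane lifts to the
side-pairing group up to sign changes. The kernel acts freely, because an element with a fixed point
is an involution (`sq_eq_one_of_smul_eq`) and a finite computation excludes the nontrivial
reductions that an involution could have.

If all elements of the kernel had determinant one, the cross-section would be orientable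
(`orientable_of_det_eq_one`). For a non-orientable `Y` the kernel thus contains an
orientation-reversing element, so `Y⁺` is the quotient of hyperbolic three-space by the
orientation-preserving part `deckGroup` of the kernel, which is its fundamental group.

On the arithmetic side, `SL(2, ℤ[i])` acts on a lattice of Hermitian forms isometric to the standard
Lorentzian lattice. This identifies `Γ(1+i)` with the determinant one part of `lorentzTwo 3`
(`range_thetaHom`, `thetaHom_eq_one_iff`). Hence `π₁(Y⁺)` becomes the kernel of a homomorphism from
`Γ(1+i)` to the abelian group `(ℤ/2)³`, so it is normal there and contains all commutators. The
orientation-reversing element keeps this homomorphism surjective, and the index is `8 · |SL(2, 𝔽₂)|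
= 8 · 6 = 48`. -/

/-- A consequence of the Cauchy–Schwarz inequality: two vectors in the open forward light cone,
one of them with its space part reversed, have a negative Lorentzian inner product. -/
theorem sum_mul_add_mul_pos {R ι : Type*} [CommRing R] [LinearOrder R] [IsStrictOrderedRing R]
    [Fintype ι] (a b : ι → R) {s t : R} (hs : 0 < s) (ht : 0 < t)
    (ha : ∑ i, a i ^ 2 < s ^ 2) (hb : ∑ i, b i ^ 2 < t ^ 2) :
    0 < ∑ i, a i * b i + s * t := by
  have h1 : (∑ i, a i * b i) ^ 2 ≤ (∑ i, a i ^ 2) * ∑ i, b i ^ 2 :=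
    Finset.sum_mul_sq_le_sq_mul_sq _ _ _
  have h2 : (∑ i, a i ^ 2) * ∑ i, b i ^ 2 < s ^ 2 * t ^ 2 := by
    have : 0 ≤ ∑ i, b i ^ 2 := Finset.sum_nonneg fun i _ => sq_nonneg _
    have : 0 ≤ ∑ i, a i ^ 2 := Finset.sum_nonneg fun i _ => sq_nonneg _
    have : 0 < s ^ 2 := by positivity
    nlinarith
  have h3 : (∑ i, a i * b i) ^ 2 < (s * t) ^ 2 := by rw [mul_pow]; exact h1.trans_lt h2
  have := abs_lt_of_sq_lt_sq h3 (by positivity)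
  linarith [(abs_lt.1 this).1]

/-- The Gram matrix of the Lorentzian form; the last coordinate is the time coordinate. -/
def gram (n : ℕ) : Matrix (Fin (n + 1)) (Fin (n + 1)) ℤ :=
  Matrix.diagonal fun i => if i = Fin.last n then -1 else 1

theorem gram_mul_gram (n : ℕ) : gram n * gram n = 1 := by
  rw [gram, Matrix.diagonal_mul_diagonal, ← Matrix.diagonal_one]
  congr 1
  ext i
  split_ifs <;> rfl

/-- The matrix `g` preserves the Lorentzian form. -/
def PreservesForm {n : ℕ} (g : Matrix (Fin (n + 1)) (Fin (n + 1)) ℤ) : Prop :=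
  gᵀ * gram n * g = gram n

theorem PreservesForm.eq_gram {n : ℕ} {g : Matrix (Fin (n + 1)) (Fin (n + 1)) ℤ}
    (h : PreservesForm g) : gᵀ * (gram n * g) = gram n := by
  rw [← Matrix.mul_assoc]
  exact h

theorem PreservesForm.inverse_mul {n : ℕ} {g : Matrix (Fin (n + 1)) (Fin (n + 1)) ℤ}
    (h : PreservesForm g) : gram n * gᵀ * gram n * g = 1 := by
  rw [Matrix.mul_assoc, Matrix.mul_assoc, h.eq_gram, gram_mul_gram]

theorem PreservesForm.one {n : ℕ} :
    PreservesForm (1 : Matrix (Fin (n + 1)) (Fin (n + 1)) ℤ) := by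
  rw [PreservesForm, Matrix.transpose_one, Matrix.one_mul, Matrix.mul_one]

theorem PreservesForm.mul {n : ℕ} {g h : Matrix (Fin (n + 1)) (Fin (n + 1)) ℤ}
    (hg : PreservesForm g) (hh : PreservesForm h) : PreservesForm (g * h) := by
  rw [PreservesForm, Matrix.transpose_mul, Matrix.mul_assoc, Matrix.mul_assoc,
    ← Matrix.mul_assoc (gram n), ← Matrix.mul_assoc gᵀ, hg.eq_gram, hh.eq_gram]

theorem mul_gram_mul_transpose {n : ℕ} {g : Matrix (Fin (n + 1)) (Fin (n + 1)) ℤ}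
    (h : PreservesForm g) : g * gram n * gᵀ = gram n := by
  have h1 := h.inverse_mul
  have h2 := congrArg (· * gram n) (mul_eq_one_comm.1 h1)
  simpa only [Matrix.mul_assoc, gram_mul_gram, Matrix.mul_one, Matrix.one_mul] using h2

theorem PreservesForm.inverse {n : ℕ} {g : Matrix (Fin (n + 1)) (Fin (n + 1)) ℤ}
    (h : PreservesForm g) : PreservesForm (gram n * gᵀ * gram n) := by
  have h1 : (gram n)ᵀ = gram n := Matrix.diagonal_transpose _
  have h2 := mul_gram_mul_transpose h
  rw [PreservesForm, Matrix.transpose_mul, Matrix.transpose_mul, Matrix.transpose_transpose, h1]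
  simp only [Matrix.mul_assoc] at h2 ⊢
  rw [← Matrix.mul_assoc (gram n) (gram n), gram_mul_gram, Matrix.one_mul,
    ← Matrix.mul_assoc _ gᵀ, ← Matrix.mul_assoc g, h2, gram_mul_gram, Matrix.mul_one]

theorem transpose_mul_gram_mul_apply {n : ℕ} (g : Matrix (Fin (n + 1)) (Fin (n + 1)) ℤ)
    (i k : Fin (n + 1)) : (gᵀ * gram n * g) i k =
      ∑ l : Fin n, g l.castSucc i * g l.castSucc k - g (Fin.last n) i * g (Fin.last n) k := by
  rw [Matrix.mul_apply, Fin.sum_univ_castSucc]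
  simp [gram, Fin.castSucc_ne_last, sub_eq_add_neg]

theorem mul_gram_mul_transpose_apply {n : ℕ} (g : Matrix (Fin (n + 1)) (Fin (n + 1)) ℤ)
    (i k : Fin (n + 1)) : (g * gram n * gᵀ) i k =
      ∑ l : Fin n, g i l.castSucc * g k l.castSucc - g i (Fin.last n) * g k (Fin.last n) := by
  simpa using transpose_mul_gram_mul_apply gᵀ i k

theorem gram_last (n : ℕ) : gram n (Fin.last n) (Fin.last n) = -1 := by simp [gram]

theorem sum_last_row_sq {n : ℕ} {g : Matrix (Fin (n + 1)) (Fin (n + 1)) ℤ}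
    (h : PreservesForm g) :
    ∑ l : Fin n, g (Fin.last n) l.castSucc ^ 2 = g (Fin.last n) (Fin.last n) ^ 2 - 1 := by
  have := mul_gram_mul_transpose_apply g (Fin.last n) (Fin.last n)
  rw [mul_gram_mul_transpose h, gram_last] at this
  simp only [pow_two]
  linarith

theorem sum_last_col_sq {n : ℕ} {g : Matrix (Fin (n + 1)) (Fin (n + 1)) ℤ}
    (h : PreservesForm g) :
    ∑ l : Fin n, g l.castSucc (Fin.last n) ^ 2 = g (Fin.last n) (Fin.last n) ^ 2 - 1 := by
  have := transpose_mul_gram_mul_apply g (Fin.last n) (Fin.last n)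
  rw [h, gram_last] at this
  simp only [pow_two]
  linarith

/-- The matrix `g` is an integral isometry of hyperbolic `n`-space that is congruent to the
identity modulo two. -/
structure IsLorentzTwo {n : ℕ} (g : Matrix (Fin (n + 1)) (Fin (n + 1)) ℤ) : Prop where
  form : PreservesForm g
  congr : ∃ A : Matrix (Fin (n + 1)) (Fin (n + 1)) ℤ, g = 1 - (2 : ℤ) • A
  pos : 0 < g (Fin.last n) (Fin.last n)

namespace IsLorentzTwo

variable {n : ℕ} {g h : Matrix (Fin (n + 1)) (Fin (n + 1)) ℤ}

theorem one : IsLorentzTwo (1 : Matrix (Fin (n + 1)) (Fin (n + 1)) ℤ) :=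
  ⟨PreservesForm.one, ⟨0, by rw [smul_zero, sub_zero]⟩, by rw [Matrix.one_apply_eq]; exact one_pos⟩

theorem mul (hg : IsLorentzTwo g) (hh : IsLorentzTwo h) : IsLorentzTwo (g * h) := by
  obtain ⟨A, hA⟩ := hg.congr
  obtain ⟨B, hB⟩ := hh.congr
  refine ⟨hg.form.mul hh.form, ⟨A + B - (2 : ℤ) • (A * B), ?_⟩, ?_⟩
  · rw [hA, hB]
    simp only [sub_mul, mul_sub, smul_mul_assoc, mul_smul_comm, smul_sub, smul_add, one_mul,
      mul_one]
    abel
  · rw [Matrix.mul_apply, Fin.sum_univ_castSucc]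
    refine sum_mul_add_mul_pos _ _ hg.pos hh.pos ?_ ?_
    · rw [sum_last_row_sq hg.form]; linarith
    · rw [sum_last_col_sq hh.form]; linarith

theorem inverse (hg : IsLorentzTwo g) : IsLorentzTwo (gram n * gᵀ * gram n) := by
  obtain ⟨A, hA⟩ := hg.congr
  refine ⟨hg.form.inverse, ⟨gram n * Aᵀ * gram n, ?_⟩, ?_⟩
  · rw [hA, Matrix.transpose_sub, Matrix.transpose_one, Matrix.transpose_smul, mul_sub, sub_mul,
      mul_one, gram_mul_gram, mul_smul_comm, smul_mul_assoc]
  · simpa [gram] using hg.pos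

end IsLorentzTwo

/-- The principal congruence subgroup of level two of the group of integral isometries of
hyperbolic `n`-space. -/
def lorentzTwo (n : ℕ) : Subgroup (GL (Fin (n + 1)) ℤ) where
  carrier := {g | IsLorentzTwo g.1}
  one_mem' := IsLorentzTwo.one
  mul_mem' hg hh := IsLorentzTwo.mul hg hh
  inv_mem' {g} hg := by
    have h : ((g⁻¹ : GL (Fin (n + 1)) ℤ) : Matrix _ _ ℤ)
        = gram n * (g : Matrix _ _ ℤ)ᵀ * gram n :=
      Units.inv_eq_of_mul_eq_one_left (PreservesForm.inverse_mul hg.form)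
    rw [Set.mem_ofPred_eq, h]
    exact IsLorentzTwo.inverse hg

theorem isLorentzTwo {n : ℕ} {g : GL (Fin (n + 1)) ℤ} (hg : g ∈ lorentzTwo n) :
    IsLorentzTwo g.1 := hg

/-! ### Hyperbolic space -/

/-- The Lorentzian inner product on `ℝⁿ⁺¹`. -/
def minkowski {n : ℕ} (x y : Fin (n + 1) → ℝ) : ℝ :=
  (∑ i : Fin n, x i.castSucc * y i.castSucc) - x (Fin.last n) * y (Fin.last n)

/-- Hyperbolic `n`-space. -/
abbrev Hyp (n : ℕ) : Type :=
  {x : Fin (n + 1) → ℝ // minkowski x x = -1 ∧ 0 < x (Fin.last n)}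

/-- The linear action of an integral matrix on real vectors. -/
def linAct {n : ℕ} (g : GL (Fin n) ℤ) (x : Fin n → ℝ) : Fin n → ℝ :=
  (g : Matrix (Fin n) (Fin n) ℤ).map (Int.cast : ℤ → ℝ) *ᵥ x

theorem linAct_apply {n : ℕ} (g : GL (Fin n) ℤ) (x : Fin n → ℝ) (i : Fin n) :
    linAct g x i = ∑ k, ((g : Matrix _ _ ℤ) i k : ℝ) * x k := by
  simp [linAct, Matrix.mulVec, dotProduct]

theorem linAct_one {n : ℕ} (x : Fin n → ℝ) : linAct 1 x = x := by
  simp [linAct]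

theorem linAct_mul {n : ℕ} (g h : GL (Fin n) ℤ) (x : Fin n → ℝ) :
    linAct (g * h) x = linAct g (linAct h x) := by
  have hm : ((g * h : GL (Fin n) ℤ) : Matrix (Fin n) (Fin n) ℤ).map (Int.cast : ℤ → ℝ)
      = (g : Matrix (Fin n) (Fin n) ℤ).map (Int.cast : ℤ → ℝ)
        * (h : Matrix (Fin n) (Fin n) ℤ).map (Int.cast : ℤ → ℝ) := by
    rw [Units.val_mul]
    exact Matrix.map_mul (f := Int.castRingHom ℝ)
  simp only [linAct, hm, Matrix.mulVec_mulVec]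

theorem continuous_linAct {n : ℕ} (g : GL (Fin n) ℤ) : Continuous (linAct g) := by
  unfold linAct
  fun_prop

theorem minkowski_eq_dotProduct {n : ℕ} (x y : Fin (n + 1) → ℝ) :
    minkowski x y = x ⬝ᵥ ((gram n).map (Int.cast : ℤ → ℝ) *ᵥ y) := by
  rw [dotProduct, Fin.sum_univ_castSucc, minkowski]
  simp [gram, Matrix.diagonal_map, Matrix.mulVec_diagonal, Fin.castSucc_ne_last, sub_eq_add_neg]

theorem minkowski_linAct {n : ℕ} {g : GL (Fin (n + 1)) ℤ}
    (h : PreservesForm g.1) (x y : Fin (n + 1) → ℝ) :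
    minkowski (linAct g x) (linAct g y) = minkowski x y := by
  have h1 : ((g : Matrix _ _ ℤ).map (Int.cast : ℤ → ℝ))ᵀ * (gram n).map (Int.cast : ℤ → ℝ)
      * (g : Matrix _ _ ℤ).map (Int.cast : ℤ → ℝ) = (gram n).map (Int.cast : ℤ → ℝ) := by
    have := congrArg (Int.castRingHom ℝ).mapMatrix h
    rwa [map_mul, map_mul] at this
  rw [minkowski_eq_dotProduct, minkowski_eq_dotProduct x]
  conv_rhs => rw [← h1]
  rw [linAct, linAct, ← Matrix.vecMul_transpose, ← Matrix.dotProduct_mulVec, Matrix.mulVec_mulVec,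
    Matrix.mulVec_mulVec, Matrix.mul_assoc]

theorem sum_sq_eq {n : ℕ} (x : Hyp n) :
    ∑ i : Fin n, x.1 i.castSucc ^ 2 = x.1 (Fin.last n) ^ 2 - 1 := by
  have := x.2.1
  simp only [minkowski, ← pow_two] at this
  linarith

theorem linAct_mem {n : ℕ} {g : GL (Fin (n + 1)) ℤ} (hg : g ∈ lorentzTwo n) (x : Hyp n) :
    minkowski (linAct g x.1) (linAct g x.1) = -1 ∧ 0 < linAct g x.1 (Fin.last n) := by
  refine ⟨by rw [minkowski_linAct (isLorentzTwo hg).form]; exact x.2.1, ?_⟩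
  rw [linAct_apply, Fin.sum_univ_castSucc]
  refine sum_mul_add_mul_pos _ _ (by exact_mod_cast (isLorentzTwo hg).pos) x.2.2 ?_ ?_
  · have := sum_last_row_sq (isLorentzTwo hg).form
    have h : ∑ l : Fin n, ((g : Matrix _ _ ℤ) (Fin.last n) l.castSucc : ℝ) ^ 2
      = ((g : Matrix _ _ ℤ) (Fin.last n) (Fin.last n) : ℝ) ^ 2 - 1 := by exact_mod_cast this
    rw [h]; linarith
  · rw [sum_sq_eq]; linarith

instance (n : ℕ) : MulAction (lorentzTwo n) (Hyp n) where
  smul g x := ⟨linAct g x.1, linAct_mem g.2 x⟩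
  one_smul x := Subtype.ext (linAct_one x.1)
  mul_smul g h x := Subtype.ext (linAct_mul g.1 h.1 x.1)

theorem coe_smul {n : ℕ} (g : lorentzTwo n) (x : Hyp n) : (g • x).1 = linAct g x.1 := rfl

instance (n : ℕ) : ContinuousConstSMul (lorentzTwo n) (Hyp n) where
  continuous_const_smul g :=
    ((continuous_linAct g.1).comp continuous_subtype_val).subtype_mk _

/-! ### Hyperbolic space is contractible and locally compact -/

/-- The point of hyperbolic space with given space coordinates. -/
noncomputable def lift {n : ℕ} (v : Fin n → ℝ) : Hyp n :=
  ⟨Fin.snoc (α := fun _ => ℝ) v (√(1 + ∑ i, v i ^ 2)), by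
    have h : 0 < 1 + ∑ i, v i ^ 2 := by positivity
    constructor
    · simp only [minkowski, Fin.snoc_castSucc, Fin.snoc_last, Real.mul_self_sqrt h.le, ← pow_two]
      ring
    · simpa using h⟩

/-- Hyperbolic space is homeomorphic to Euclidean space, by projection to the space coordinates. -/
noncomputable def spaceHomeo (n : ℕ) : Hyp n ≃ₜ (Fin n → ℝ) where
  toFun x i := x.1 i.castSucc
  invFun := lift
  left_inv x := by
    refine Subtype.ext (funext fun i => ?_)
    induction i using Fin.lastCases with
    | last =>
      simp only [lift, Fin.snoc_last, sum_sq_eq]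
      rw [add_sub_cancel, Real.sqrt_sq x.2.2.le]
    | cast i => simp [lift]
  right_inv v := by
    ext i
    simp [lift]
  continuous_toFun := continuous_pi fun i => (continuous_apply _).comp continuous_subtype_val
  continuous_invFun := by
    refine Continuous.subtype_mk (continuous_pi fun i => ?_) _
    induction i using Fin.lastCases with
    | last => simp only [Fin.snoc_last]; fun_prop
    | cast i => simp only [Fin.snoc_castSucc]; fun_prop

instance (n : ℕ) : ContractibleSpace (Hyp n) := (spaceHomeo n).contractibleSpace

instance (n : ℕ) : LocallyCompactSpace (Hyp n) :=
  (spaceHomeo n).isClosedEmbedding.locallyCompactSpace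

/-! ### The action is properly discontinuous -/

/-- With `o` the last basis vector, the corner entry is `cosh d(o, g o)`. The triangle inequality
through `y = g x` bounds that distance by `d(o, y) + d(o, x)`, and `cosh (a + b) ≤ 2 cosh a cosh b`.
Together with `abs_apply_le` this gives proper discontinuity. -/
theorem last_le_of_linAct_eq {n : ℕ} {g : GL (Fin (n + 1)) ℤ} (hg : g ∈ lorentzTwo n)
    {x y : Hyp n} (h : linAct g x.1 = y.1) :
    (g.1 (Fin.last n) (Fin.last n) : ℝ) ≤ 2 * x.1 (Fin.last n) * y.1 (Fin.last n) := by
  set u : Fin (n + 1) → ℝ := fun i => g.1 i (Fin.last n) with hu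
  have h0 : linAct g (Pi.single (Fin.last n) 1) = u := by
    ext i
    simp [linAct_apply, hu, Pi.single_apply]
  have h1 : minkowski u y.1 = - x.1 (Fin.last n) := by
    rw [← h, ← h0, minkowski_linAct (isLorentzTwo hg).form]
    simp [minkowski, Fin.castSucc_ne_last]
  have h2 : ∑ i : Fin n, u i.castSucc ^ 2 = u (Fin.last n) ^ 2 - 1 := by
    have := sum_last_col_sq (isLorentzTwo hg).form
    simp only [hu]
    exact_mod_cast this
  have h3 := Finset.sum_mul_sq_le_sq_mul_sq Finset.univ (fun i : Fin n => u i.castSucc)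
    (fun i : Fin n => y.1 i.castSucc)
  rw [h2, sum_sq_eq] at h3
  rw [minkowski] at h1
  have h4 : 0 < u (Fin.last n) := by simpa [hu] using (isLorentzTwo hg).pos
  have h5 := y.2.2
  have h6 := x.2.2
  change u (Fin.last n) ≤ _
  have h7 : ∑ i : Fin n, u i.castSucc * y.1 i.castSucc
      = u (Fin.last n) * y.1 (Fin.last n) - x.1 (Fin.last n) := by linarith
  rw [h7] at h3
  by_contra! hlt
  have : u (Fin.last n) * u (Fin.last n)
      > u (Fin.last n) * (2 * x.1 (Fin.last n) * y.1 (Fin.last n)) :=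
    mul_lt_mul_of_pos_left hlt h4
  have h8 : 0 ≤ y.1 (Fin.last n) ^ 2 - 1 := by
    rw [← sum_sq_eq]
    exact Finset.sum_nonneg fun i _ => sq_nonneg _
  nlinarith [sq_nonneg (x.1 (Fin.last n))]

/-- The space parts of the last row and column have square norm `g_nn ^ 2 - 1`. Any other column is
a unit spacelike vector, so its space part has square norm `1 + g_nk ^ 2 ≤ g_nn ^ 2`. -/
theorem abs_apply_le {n : ℕ} {g : Matrix (Fin (n + 1)) (Fin (n + 1)) ℤ} (hg : IsLorentzTwo g)
    (i k : Fin (n + 1)) : |g i k| ≤ g (Fin.last n) (Fin.last n) := by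
  have hrow : ∀ k, |g (Fin.last n) k| ≤ g (Fin.last n) (Fin.last n) := by
    intro k
    induction k using Fin.lastCases with
    | last => exact (abs_of_pos hg.pos).le
    | cast k =>
      have h1 := Finset.single_le_sum (f := fun l : Fin n => g (Fin.last n) l.castSucc ^ 2)
        (fun l _ => sq_nonneg _) (Finset.mem_univ k)
      rw [sum_last_row_sq hg.form] at h1
      exact abs_le_of_sq_le_sq (by linarith) hg.pos.le
  induction i using Fin.lastCases with
  | last => exact hrow k
  | cast i =>
    have h1 := Finset.single_le_sum (f := fun l : Fin n => g l.castSucc k ^ 2)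
      (fun l _ => sq_nonneg _) (Finset.mem_univ i)
    have h2 := transpose_mul_gram_mul_apply g k k
    rw [show gᵀ * gram n * g = gram n from hg.form] at h2
    simp only [← pow_two] at h2
    induction k using Fin.lastCases with
    | last =>
      rw [sum_last_col_sq hg.form] at h1
      exact abs_le_of_sq_le_sq (by linarith) hg.pos.le
    | cast k =>
      have h3 := Finset.single_le_sum (f := fun l : Fin n => g (Fin.last n) l.castSucc ^ 2)
        (fun l _ => sq_nonneg _) (Finset.mem_univ k)
      rw [sum_last_row_sq hg.form] at h3
      have h4 : gram n k.castSucc k.castSucc = 1 := by simp [gram, Fin.castSucc_ne_last]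
      rw [h4] at h2
      exact abs_le_of_sq_le_sq (by linarith) hg.pos.le

theorem finite_setOf_last_le (n : ℕ) (C : ℝ) :
    {g : lorentzTwo n | (g.1.1 (Fin.last n) (Fin.last n) : ℝ) ≤ C}.Finite := by
  have hf : Function.Injective fun (g : lorentzTwo n) (i k : Fin (n + 1)) => g.1.1 i k := by
    intro g h e
    exact Subtype.ext (Units.ext (Matrix.ext fun i k => congrFun (congrFun e i) k))
  refine Set.Finite.subset (Set.Finite.preimage hf.injOn (Set.Finite.pi' fun i =>
    Set.Finite.pi' fun k => Set.finite_Icc (-⌊C⌋) ⌊C⌋)) ?_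
  intro g hg i k
  exact abs_le.1 ((abs_apply_le (isLorentzTwo g.2) i k).trans (Int.le_floor.2 hg))

instance (n : ℕ) : ProperlyDiscontinuousSMul (lorentzTwo n) (Hyp n) where
  finite_disjoint_inter_image {K L} hK hL := by
    have hc : Continuous fun x : Hyp n => x.1 (Fin.last n) :=
      (continuous_apply _).comp continuous_subtype_val
    obtain ⟨a, ha⟩ := (hK.image hc).bddAbove
    obtain ⟨b, hb⟩ := (hL.image hc).bddAbove
    refine (finite_setOf_last_le n (2 * a * b)).subset ?_
    rintro g ⟨y, ⟨x, hx, hxy⟩, hy⟩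
    have h1 := last_le_of_linAct_eq g.2 (x := x) (y := y) (congrArg Subtype.val hxy)
    have h2 := ha ⟨x, hx, rfl⟩
    have h3 := hb ⟨y, hy, rfl⟩
    refine h1.trans ?_
    have := x.2.2
    have := y.2.2
    dsimp only at h2 h3
    have : 0 ≤ a := by linarith
    gcongr

/-! ### Torsion -/

/-- Substituting the equation into itself shows that `B` is divisible by every power of two. -/
theorem eq_zero_of_eq_smul_sq {m : Type*} [Fintype m] [DecidableEq m] {B : Matrix m m ℤ} {e : ℤ}
    (h : B = (2 * e) • (B * B)) : B = 0 := by
  have h1 : ∀ k : ℕ, ∃ C : Matrix m m ℤ, B = (2 ^ k : ℤ) • C := by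
    intro k
    induction k with
    | zero => exact ⟨B, by simp⟩
    | succ k ih =>
      obtain ⟨C, hC⟩ := ih
      refine ⟨(e * 2 ^ k) • (C * C), ?_⟩
      rw [h, hC, smul_mul_smul_comm, smul_smul, smul_smul]
      congr 1
      ring
  ext i k
  obtain ⟨C, hC⟩ := h1 (B i k).natAbs
  refine Int.eq_zero_of_abs_lt_dvd (m := 2 ^ (B i k).natAbs) ⟨C i k, ?_⟩ ?_
  · conv_lhs => rw [hC]
    simp
  · rw [Int.abs_eq_natAbs]
    exact_mod_cast Nat.lt_two_pow_self

/-- The powers `g ^ 2 ^ k` tend to the identity 2-adically, while a fixed point bounds their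
entries, so one of them is the identity. Conversely, a matrix congruent to the identity modulo four
whose square is the identity is itself the identity; this removes the doublings down to `g ^ 2`,
where congruence modulo two alone allows genuine involutions. -/
theorem sq_eq_one_of_smul_eq {n : ℕ} {g : lorentzTwo n} {x : Hyp n} (h : g • x = x) :
    g ^ 2 = 1 := by
  have hpow : ∀ k : ℕ, ∃ B : Matrix (Fin (n + 1)) (Fin (n + 1)) ℤ,
      (g ^ 2 ^ k).1.1 = 1 + (2 ^ (k + 1) : ℤ) • B := by
    intro k
    induction k with
    | zero =>
      obtain ⟨A, hA⟩ := (isLorentzTwo g.2).congr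
      exact ⟨-A, by simp [hA, sub_eq_add_neg]⟩
    | succ k ih =>
      obtain ⟨B, hB⟩ := ih
      refine ⟨B + (2 ^ k : ℤ) • (B * B), ?_⟩
      rw [pow_succ, pow_mul, pow_two, Subgroup.coe_mul, Units.val_mul, hB]
      simp only [add_mul, mul_add, smul_mul_assoc, mul_smul_comm, one_mul, mul_one, smul_add,
        smul_smul]
      rw [show (2 : ℤ) ^ (k + 1 + 1) = 2 ^ (k + 1) + 2 ^ (k + 1) by ring, add_smul,
        show ((2 : ℤ) ^ (k + 1) + 2 ^ (k + 1)) * 2 ^ k = 2 ^ (k + 1) * 2 ^ (k + 1) by ring]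
      abel
  have hfix : ∀ k : ℕ, g ^ k • x = x := by
    intro k
    induction k with
    | zero => simp
    | succ k ih => rw [pow_succ, mul_smul, h, ih]
  obtain ⟨k, hk⟩ : ∃ k : ℕ, g ^ 2 ^ (k + 1) = 1 := by
    set C := ⌊2 * x.1 (Fin.last n) * x.1 (Fin.last n)⌋ with hC
    -- All entries of powers of `g` are at most `C` in absolute value, so a power that is congruent
    -- to the identity modulo `2 ^ (|C| + 2) > C + 1` equals it.
    refine ⟨C.natAbs, Subtype.ext (Units.ext (Matrix.ext fun i l => ?_))⟩
    obtain ⟨B, hB⟩ := hpow (C.natAbs + 1)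
    set G := g ^ 2 ^ (C.natAbs + 1) with hG
    have h1 : |G.1.1 i l| ≤ C := (abs_apply_le (isLorentzTwo G.2) i l).trans
      (Int.le_floor.2 (last_le_of_linAct_eq G.2 (congrArg Subtype.val (hfix _))))
    rw [← sub_eq_zero]
    refine Int.eq_zero_of_abs_lt_dvd (m := 2 ^ (C.natAbs + 1 + 1)) ⟨B i l, ?_⟩ ?_
    · rw [hB, Subgroup.coe_one, Units.val_one, Matrix.add_apply, add_sub_cancel_left,
        Matrix.smul_apply, smul_eq_mul]
    · have h2 : |(1 : Matrix (Fin (n + 1)) (Fin (n + 1)) ℤ) i l| ≤ 1 := by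
        rw [Matrix.one_apply]; split_ifs <;> simp
      have h3 : C < 2 ^ C.natAbs := (Int.le_natAbs).trans_lt (by exact_mod_cast Nat.lt_two_pow_self)
      have h4 : (1 : ℤ) ≤ 2 ^ C.natAbs := one_le_pow₀ (by norm_num)
      calc _ ≤ |G.1.1 i l| + |(1 : Matrix (Fin (n + 1)) (Fin (n + 1)) ℤ) i l| := abs_sub _ _
        _ < 2 ^ (C.natAbs + 1 + 1) := by rw [pow_succ, pow_succ]; linarith
  have hdown : ∀ k : ℕ, g ^ 2 ^ (k + 1) = 1 → g ^ 2 = 1 := by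
    intro k
    induction k with
    | zero => exact fun h => by simpa using h
    | succ k ih =>
      intro hk
      refine ih ?_
      obtain ⟨B, hB⟩ := hpow (k + 1)
      set G := g ^ 2 ^ (k + 1) with hG
      have h1 : G ^ 2 = 1 := by rw [hG, ← pow_mul, ← pow_succ, hk]
      have h2 : G.1.1 * G.1.1 = 1 := by
        rw [pow_two] at h1
        exact congrArg (fun z : lorentzTwo n => z.1.1) h1
      rw [hB] at h2
      have h3 : (2 ^ (k + 1 + 1 + 1) : ℤ) • (B + (2 ^ (k + 1) : ℤ) • (B * B)) = 0 := by
        rw [← sub_eq_zero] at h2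
        rw [← h2]
        simp only [add_mul, mul_add, smul_mul_assoc, mul_smul_comm, one_mul, mul_one, smul_add,
          smul_smul]
        rw [show (2 : ℤ) ^ (k + 1 + 1 + 1) = 2 ^ (k + 1 + 1) + 2 ^ (k + 1 + 1) by ring, add_smul,
          show ((2 : ℤ) ^ (k + 1 + 1) + 2 ^ (k + 1 + 1)) * 2 ^ (k + 1)
            = 2 ^ (k + 1 + 1) * 2 ^ (k + 1 + 1) by ring]
        abel
      rw [smul_eq_zero_iff_right (by positivity)] at h3
      have h4 : B = 0 := by
        refine eq_zero_of_eq_smul_sq (e := - 2 ^ k) ?_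
        have h5 := eq_neg_of_add_eq_zero_left h3
        rw [← neg_smul] at h5
        convert h5 using 2
        ring
      exact Subtype.ext (Units.ext (by rw [hB, h4]; simp))
  exact hdown k hk

/-! ### Reduction modulo four -/

/-- For a matrix `g = 1 - 2 A`, the reduction of `A` modulo two. -/
def half {m : Type*} [DecidableEq m] (g : Matrix m m ℤ) : Matrix m m (ZMod 2) :=
  Matrix.of fun i k => (((1 - g) i k / 2 : ℤ) : ZMod 2)

theorem half_eq {m : Type*} [DecidableEq m] {g A : Matrix m m ℤ} (h : g = 1 - (2 : ℤ) • A) :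
    half g = A.map (Int.cast : ℤ → ZMod 2) := by
  ext i k
  simp [half, h]

/-- Since `(1 - 2A)(1 - 2B) = 1 - 2(A + B - 2AB)`, the cross term disappears modulo two. -/
theorem half_mul {m : Type*} [Fintype m] [DecidableEq m] {g h : Matrix m m ℤ}
    (hg : ∃ A : Matrix m m ℤ, g = 1 - (2 : ℤ) • A) (hh : ∃ B : Matrix m m ℤ, h = 1 - (2 : ℤ) • B) :
    half (g * h) = half g + half h := by
  obtain ⟨A, hA⟩ := hg
  obtain ⟨B, hB⟩ := hh
  have h1 : g * h = 1 - (2 : ℤ) • (A + B - (2 : ℤ) • (A * B)) := by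
    rw [hA, hB]
    simp only [sub_mul, mul_sub, smul_mul_assoc, mul_smul_comm, smul_sub, smul_add, one_mul,
      mul_one]
    abel
  rw [half_eq hA, half_eq hB, half_eq h1]
  ext i k
  have : (2 : ZMod 2) = 0 := rfl
  simp [this, -zsmul_eq_mul]

theorem half_one {m : Type*} [DecidableEq m] : half (1 : Matrix m m ℤ) = 0 := by
  ext i k
  simp [half]

/-! ### Generation by reflections in dimension three -/

/-- The unit normal vectors of the six walls of the fundamental polyhedron of `lorentzTwo 3`. -/
def wall : Fin 6 → Fin 4 → ℤ :=
  ![![1, 0, 0, 0], ![0, 1, 0, 0], ![0, 0, 1, 0], ![1, 1, 0, 1], ![1, 0, 1, 1], ![0, 1, 1, 1]]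

/-- The rank one matrix `B` such that `1 - 2 B` is the reflection in a wall. -/
def wallProj (i : Fin 6) : Matrix (Fin 4) (Fin 4) ℤ :=
  Matrix.of fun a b => wall i a * (if b = 3 then -wall i b else wall i b)

theorem sub_wallProj_mul_self (i : Fin 6) :
    (1 - (2 : ℤ) • wallProj i) * (1 - (2 : ℤ) • wallProj i) = 1 := by
  revert i
  decide

/-- The reflection in a wall. -/
def wallRefl (i : Fin 6) : lorentzTwo 3 :=
  ⟨⟨1 - (2 : ℤ) • wallProj i, 1 - (2 : ℤ) • wallProj i, sub_wallProj_mul_self i,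
    sub_wallProj_mul_self i⟩, by
    change IsLorentzTwo _
    refine ⟨?_, ⟨wallProj i, rfl⟩, ?_⟩
    · unfold PreservesForm
      revert i
      decide
    · revert i
      decide⟩

theorem coe_wallRefl (i : Fin 6) : (wallRefl i).1.1 = 1 - (2 : ℤ) • wallProj i := rfl

theorem wallRefl_mul_self (i : Fin 6) : wallRefl i * wallRefl i = 1 :=
  Subtype.ext (Units.ext (sub_wallProj_mul_self i))

theorem half_wallRefl (i : Fin 6) :
    half (wallRefl i).1.1 = (wallProj i).map (Int.cast : ℤ → ZMod 2) := half_eq rfl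

theorem wallRefl_mul_apply (i : Fin 6) (g : lorentzTwo 3) (k : Fin 4) :
    (wallRefl i * g).1.1 k 3 = g.1.1 k 3 - 2 * (wall i k * (wall i 0 * g.1.1 0 3
      + wall i 1 * g.1.1 1 3 + wall i 2 * g.1.1 2 3 - wall i 3 * g.1.1 3 3)) := by
  rw [Subgroup.coe_mul, Units.val_mul, coe_wallRefl, sub_mul, one_mul, smul_mul_assoc,
    Matrix.sub_apply, Matrix.smul_apply, Matrix.mul_apply, Fin.sum_univ_four]
  simp only [wallProj, Matrix.of_apply, smul_eq_mul]
  simp only [Fin.isValue, Fin.reduceEq, if_false, if_true]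
  ring

/-- If `a + b ≤ t`, then `2ab ≤ c² + 1 ≤ ab + 1`. Evenness forces `ab = 0` and `c = 0`, leaving a
square equal to `t² - 1`, impossible for `t > 1`. This is the estimate that drives the descent. -/
theorem lt_add_of_sq_add_sq {a b c t : ℤ} (ha : 0 ≤ a) (hb : 0 ≤ b) (hc : 0 ≤ c) (hca : c ≤ a)
    (hcb : c ≤ b) (ht : 1 < t) (h : a ^ 2 + b ^ 2 + c ^ 2 = t ^ 2 - 1) (ha2 : 2 ∣ a) (hb2 : 2 ∣ b)
    (hc2 : 2 ∣ c) : t < a + b := by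
  by_contra! hle
  have h1 : (a + b) ^ 2 ≤ t ^ 2 := by gcongr
  have h2 : c * c ≤ a * b := mul_le_mul hca hcb hc ha
  have h3 : c = 0 := by
    by_contra h0
    have : 2 ≤ c := by omega
    nlinarith
  have h4 : ∀ x : ℤ, 0 ≤ x → x ^ 2 ≠ t ^ 2 - 1 := by
    intro x hx hxt
    have : t - 1 < x := by nlinarith
    nlinarith
  by_cases ha0 : a = 0
  · exact h4 b hb (by rw [← h, ha0, h3]; ring)
  by_cases hb0 : b = 0
  · exact h4 a ha (by rw [← h, hb0, h3]; ring)
  have : 2 ≤ a := by omega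
  have : 2 ≤ b := by omega
  nlinarith

/-- All entries are bounded by the corner entry `1`, and the off-diagonal ones are even. This is the
end of the descent. -/
theorem eq_diagonal_of_last_eq_one {g : Matrix (Fin 4) (Fin 4) ℤ} (hg : IsLorentzTwo (n := 3) g)
    (h : g 3 3 = 1) : g = Matrix.diagonal (fun i => g i i) ∧ ∀ i, g i i = 1 ∨ g i i = -1 := by
  obtain ⟨A, hA⟩ := hg.congr
  have h0 : ∀ i k, -1 ≤ g i k ∧ g i k ≤ 1 := by
    intro i k
    have := abs_apply_le hg i k
    rw [show g (Fin.last 3) (Fin.last 3) = 1 from h] at this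
    exact abs_le.1 this
  constructor
  · ext i k
    rw [Matrix.diagonal_apply]
    split_ifs with hik
    · rw [hik]
    · have h1 := h0 i k
      have h2 : g i k = - (2 * A i k) := by rw [hA]; simp [hik, -zsmul_eq_mul]
      omega
  · intro i
    have h1 := h0 i i
    have h2 : g i i = 1 - 2 * A i i := by rw [hA]; simp [-zsmul_eq_mul]
    omega

/-- The group `lorentzTwo 3` is generated by the reflections in the six walls. -/
theorem lorentzTwo_induction {P : lorentzTwo 3 → Prop} (one : P 1)
    (mul : ∀ i g, P g → P (wallRefl i * g)) (g : lorentzTwo 3) : P g := by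
  have step : ∀ i g, P (wallRefl i * g) → P g := by
    intro i g h
    have := mul i _ h
    rwa [← mul_assoc, wallRefl_mul_self, one_mul] at this
  suffices H : ∀ (N : ℕ) (g : lorentzTwo 3), g.1.1 3 3 = N → P g by
    exact H (g.1.1 3 3).toNat g (Int.toNat_of_nonneg (isLorentzTwo g.2).pos.le).symm
  intro N
  induction N using Nat.strong_induction_on with
  | _ N ih =>
  have hpos : ∀ g : lorentzTwo 3, 0 < g.1.1 3 3 := fun g => (isLorentzTwo g.2).pos
  have main : ∀ g : lorentzTwo 3, g.1.1 3 3 = N → 0 ≤ g.1.1 0 3 → 0 ≤ g.1.1 1 3 → 0 ≤ g.1.1 2 3 →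
      P g := by
    intro g hN h0 h1 h2
    by_cases hlt : 1 < g.1.1 3 3
    · have hsum : g.1.1 0 3 ^ 2 + g.1.1 1 3 ^ 2 + g.1.1 2 3 ^ 2 = g.1.1 3 3 ^ 2 - 1 := by
        have := sum_last_col_sq (isLorentzTwo g.2).form
        rwa [Fin.sum_univ_three] at this
      have heven : ∀ k : Fin 4, k ≠ 3 → 2 ∣ g.1.1 k 3 := by
        intro k hk
        obtain ⟨A, hA⟩ := (isLorentzTwo g.2).congr
        exact ⟨- A k 3, by rw [hA]; simp [hk, -zsmul_eq_mul]⟩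
      have red : ∀ i, (wallRefl i * g).1.1 3 3 < g.1.1 3 3 → P g := by
        intro i hi
        refine step i g (ih ((wallRefl i * g).1.1 3 3).toNat ?_ _ ?_)
        · have := hpos (wallRefl i * g)
          omega
        · exact (Int.toNat_of_nonneg (hpos _).le).symm
      have e0 := heven 0 (by decide)
      have e1 := heven 1 (by decide)
      have e2 := heven 2 (by decide)
      rcases le_total (g.1.1 0 3) (g.1.1 1 3) with h01 | h01 <;>
        rcases le_total (g.1.1 1 3) (g.1.1 2 3) with h12 | h12 <;>
        rcases le_total (g.1.1 0 3) (g.1.1 2 3) with h02 | h02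
      -- For the two largest coordinates `a, b`, the reflection in the wall `e_a + e_b + e_3`
      -- changes the time coordinate `t` to `3t - 2(a + b)`, which is less than `t`.
      all_goals first
        | refine red 5 ?_
          have := lt_add_of_sq_add_sq h1 h2 h0 (by omega) (by omega) hlt (by linarith) e1 e2 e0
          rw [wallRefl_mul_apply]
          simp [wall]
          omega
        | refine red 4 ?_
          have := lt_add_of_sq_add_sq h0 h2 h1 (by omega) (by omega) hlt (by linarith) e0 e2 e1
          rw [wallRefl_mul_apply]
          simp [wall]
          omega
        | refine red 3 ?_
          have := lt_add_of_sq_add_sq h0 h1 h2 (by omega) (by omega) hlt (by linarith) e0 e1 e2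
          rw [wallRefl_mul_apply]
          simp [wall]
          omega
    · have h1 : g.1.1 3 3 = 1 := by have := hpos g; omega
      obtain ⟨hd, hs⟩ := eq_diagonal_of_last_eq_one (isLorentzTwo g.2) h1
      have fin : ∀ g' : lorentzTwo 3, P g' → g.1.1 = g'.1.1 → P g := by
        intro g' hg' h
        rwa [Subtype.ext (Units.ext h)]
      have hd' : g.1.1 = Matrix.diagonal ![g.1.1 0 0, g.1.1 1 1, g.1.1 2 2, 1] := by
        conv_lhs => rw [hd]
        congr 1
        ext i
        fin_cases i <;> simp [h1]
      rcases hs 0 with a | a <;> rcases hs 1 with b | b <;> rcases hs 2 with c | c <;>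
        rw [a, b, c] at hd'
      · exact fin 1 one (hd'.trans (by decide))
      · exact fin (wallRefl 2 * 1) (mul _ _ one) (hd'.trans (by decide))
      · exact fin (wallRefl 1 * 1) (mul _ _ one) (hd'.trans (by decide))
      · exact fin (wallRefl 1 * (wallRefl 2 * 1)) (mul _ _ (mul _ _ one)) (hd'.trans (by decide))
      · exact fin (wallRefl 0 * 1) (mul _ _ one) (hd'.trans (by decide))
      · exact fin (wallRefl 0 * (wallRefl 2 * 1)) (mul _ _ (mul _ _ one)) (hd'.trans (by decide))
      · exact fin (wallRefl 0 * (wallRefl 1 * 1)) (mul _ _ (mul _ _ one)) (hd'.trans (by decide))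
      · exact fin (wallRefl 0 * (wallRefl 1 * (wallRefl 2 * 1)))
          (mul _ _ (mul _ _ (mul _ _ one))) (hd'.trans (by decide))
  have main2 : ∀ g : lorentzTwo 3, g.1.1 3 3 = N → 0 ≤ g.1.1 0 3 → 0 ≤ g.1.1 1 3 → P g := by
    intro g hN h0 h1
    rcases le_total 0 (g.1.1 2 3) with h2 | h2
    · exact main g hN h0 h1 h2
    · refine step 2 g (main _ ?_ ?_ ?_ ?_) <;> rw [wallRefl_mul_apply] <;> simp [wall] <;> omega
  have main1 : ∀ g : lorentzTwo 3, g.1.1 3 3 = N → 0 ≤ g.1.1 0 3 → P g := by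
    intro g hN h0
    rcases le_total 0 (g.1.1 1 3) with h2 | h2
    · exact main2 g hN h0 h2
    · refine step 1 g (main2 _ ?_ ?_ ?_) <;> rw [wallRefl_mul_apply] <;> simp [wall] <;> omega
  intro g hN
  rcases le_total 0 (g.1.1 0 3) with h2 | h2
  · exact main1 g hN h2
  · refine step 0 g (main1 _ ?_ ?_) <;> rw [wallRefl_mul_apply] <;> simp [wall] <;> omega

/-! ### Matrices with an isolated coordinate -/

/-- The block matrix which acts by `e` on the `j`-th coordinate and by `A` on the other four. -/
def block {R : Type*} [Zero R] (j : Fin 4) (A : Matrix (Fin 4) (Fin 4) R) (e : R) :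
    Matrix (Fin 5) (Fin 5) R :=
  Matrix.of (Fin.insertNth (α := fun _ => Fin 5 → R) j.castSucc
    (Fin.insertNth (α := fun _ => R) j.castSucc e 0)
    fun a => Fin.insertNth (α := fun _ => R) j.castSucc 0 (A a))

section block

variable {R : Type*} [Zero R] (j : Fin 4) (A : Matrix (Fin 4) (Fin 4) R) (e : R)

@[simp] theorem block_same_same : block j A e j.castSucc j.castSucc = e := by simp [block]

@[simp] theorem block_same_succAbove (b : Fin 4) :
    block j A e j.castSucc (j.castSucc.succAbove b) = 0 := by simp [block]

@[simp] theorem block_succAbove_same (a : Fin 4) :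
    block j A e (j.castSucc.succAbove a) j.castSucc = 0 := by simp [block]

@[simp] theorem block_succAbove_succAbove (a b : Fin 4) :
    block j A e (j.castSucc.succAbove a) (j.castSucc.succAbove b) = A a b := by simp [block]

end block

/-- Two matrices are equal if their blocks with respect to the `j`-th coordinate are equal. -/
theorem ext_block {R : Type*} {M N : Matrix (Fin 5) (Fin 5) R} (j : Fin 4)
    (h1 : M j.castSucc j.castSucc = N j.castSucc j.castSucc)
    (h2 : ∀ b, M j.castSucc (j.castSucc.succAbove b) = N j.castSucc (j.castSucc.succAbove b))
    (h3 : ∀ a, M (j.castSucc.succAbove a) j.castSucc = N (j.castSucc.succAbove a) j.castSucc)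
    (h4 : ∀ a b, M (j.castSucc.succAbove a) (j.castSucc.succAbove b)
      = N (j.castSucc.succAbove a) (j.castSucc.succAbove b)) : M = N := by
  ext a b
  induction a using Fin.succAboveCases j.castSucc with
  | x =>
    induction b using Fin.succAboveCases j.castSucc with
    | x => exact h1
    | p b => exact h2 b
  | p a =>
    induction b using Fin.succAboveCases j.castSucc with
    | x => exact h3 a
    | p b => exact h4 a b

theorem block_mul (j : Fin 4) (A B : Matrix (Fin 4) (Fin 4) ℤ) (d e : ℤ) :
    block j A d * block j B e = block j (A * B) (d * e) := by
  apply ext_block j <;> intros <;>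
    simp [Matrix.mul_apply, Fin.sum_univ_succAbove _ j.castSucc]

theorem block_one_one (j : Fin 4) : block j (1 : Matrix (Fin 4) (Fin 4) ℤ) 1 = 1 := by
  apply ext_block j <;> intros <;>
    simp [Matrix.one_apply, (Fin.succAbove_ne _ _).symm]

theorem block_transpose (j : Fin 4) (A : Matrix (Fin 4) (Fin 4) ℤ) (e : ℤ) :
    (block j A e)ᵀ = block j Aᵀ e := by
  apply ext_block j <;> intros <;> simp

theorem block_one_sub (j : Fin 4) (A : Matrix (Fin 4) (Fin 4) ℤ) (e : ℤ) :
    block j (1 - (2 : ℤ) • A) (1 - 2 * e) = 1 - (2 : ℤ) • block j A e := by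
  apply ext_block j <;> intros <;>
    simp [Matrix.one_apply, (Fin.succAbove_ne _ _).symm, -zsmul_eq_mul]

theorem block_gram (j : Fin 4) : block j (gram 3) 1 = gram 4 := by
  revert j
  decide

theorem block_add {R : Type*} [AddZeroClass R] (j : Fin 4) (A B : Matrix (Fin 4) (Fin 4) R)
    (d e : R) : block j A d + block j B e = block j (A + B) (d + e) := by
  apply ext_block j <;> intros <;> simp

theorem half_block (j : Fin 4) (A : Matrix (Fin 4) (Fin 4) ℤ) (e : ℤ) :
    half (block j A e) = block j (half A) (((1 - e) / 2 : ℤ) : ZMod 2) := by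
  apply ext_block j <;> intros <;>
    simp [half, Matrix.one_apply, (Fin.succAbove_ne _ _).symm]

theorem block_injective {j : Fin 4} {A B : Matrix (Fin 4) (Fin 4) ℤ} {d e : ℤ}
    (h : block j A d = block j B e) : A = B ∧ d = e := by
  constructor
  · ext a b
    simpa using congrFun (congrFun h (j.castSucc.succAbove a)) (j.castSucc.succAbove b)
  · simpa using congrFun (congrFun h j.castSucc) j.castSucc

theorem last_eq_succAbove (j : Fin 4) : (Fin.last 4) = j.castSucc.succAbove (Fin.last 3) :=
  (Fin.succAbove_ne_last_last (Fin.castSucc_ne_last j)).symm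

theorem isLorentzTwo_of_block {j : Fin 4} {A : Matrix (Fin 4) (Fin 4) ℤ} {e : ℤ}
    (h : IsLorentzTwo (n := 4) (block j A e)) : IsLorentzTwo (n := 3) A := by
  refine ⟨?_, ?_, ?_⟩
  · have h1 := h.form
    rw [PreservesForm, ← block_gram j, block_transpose, block_mul, block_mul] at h1
    exact (block_injective h1).1
  · obtain ⟨B, hB⟩ := h.congr
    refine ⟨B.submatrix j.castSucc.succAbove j.castSucc.succAbove, ?_⟩
    ext a b
    have := congrFun (congrFun hB (j.castSucc.succAbove a)) (j.castSucc.succAbove b)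
    simpa [Matrix.one_apply, -zsmul_eq_mul] using this
  · have h1 := h.pos
    rwa [last_eq_succAbove j, block_succAbove_succAbove] at h1

/-- The embedding of the isometries of a coordinate hyperplane. -/
def blockHom (j : Fin 4) : GL (Fin 4) ℤ →* GL (Fin 5) ℤ :=
  Units.map
    { toFun := fun A => block j A 1
      map_one' := block_one_one j
      map_mul' := fun A B => by rw [block_mul, mul_one] }

theorem coe_blockHom (j : Fin 4) (g : GL (Fin 4) ℤ) : (blockHom j g).1 = block j g.1 1 := rfl

/-! ### The holonomy of a code -/

/-- The reduction homomorphism `g ↦ (1 - g) / 2` modulo two. -/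
def halfHom (n : ℕ) :
    lorentzTwo n →* Multiplicative (Matrix (Fin (n + 1)) (Fin (n + 1)) (ZMod 2)) where
  toFun g := Multiplicative.ofAdd (half g.1.1)
  map_one' := congrArg Multiplicative.ofAdd half_one
  map_mul' g h := congrArg Multiplicative.ofAdd
    (half_mul (isLorentzTwo g.2).congr (isLorentzTwo h.2).congr)

/-- The sign changes which a code attaches to an element of `lorentzTwo 4`, as a function of the
reduction of the element modulo four. -/
def holonomy (c : Census) :
    Matrix (Fin 5) (Fin 5) (ZMod 2) →+ (Fin 4 → ZMod 2) where
  toFun A m := A m.castSucc m.castSucc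
    + ∑ b : Fin 4, (if b = m then 0 else A m.castSucc b.castSucc)
    + ∑ p : Fin 6, (if (code c p).testBit m then A (pairs p).1 (pairs p).2 else 0)
  map_zero' := by
    ext m
    simp
  map_add' A B := by
    ext m
    simp only [Matrix.add_apply, Pi.add_apply, ← Finset.sum_add_distrib, add_add_add_comm]
    congr 1
    · congr 1
      refine Finset.sum_congr rfl fun b _ => ?_
      split_ifs <;> simp
    · refine Finset.sum_congr rfl fun p _ => ?_
      split_ifs <;> simp

theorem holonomy_apply (c : Census) (A : Matrix (Fin 5) (Fin 5) (ZMod 2)) (m : Fin 4) :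
    holonomy c A m = A m.castSucc m.castSucc
    + ∑ b : Fin 4, (if b = m then 0 else A m.castSucc b.castSucc)
    + ∑ p : Fin 6, (if (code c p).testBit m then A (pairs p).1 (pairs p).2 else 0) := rfl

/-- The rank one matrix `B` such that `1 - 2 B` is the reflection with normal vector `v`. -/
def sideProj (v : Fin 5 → ℤ) : Matrix (Fin 5) (Fin 5) ℤ :=
  Matrix.of fun a b => v a * (if b = 4 then -v b else v b)

theorem reflection_eq (v : Fin 5 → ℤ) : reflection v = 1 - (2 : ℤ) • sideProj v := by
  ext a b
  simp [reflection, sideProj, Matrix.one_apply, -zsmul_eq_mul, mul_assoc]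

/-- The diagonal matrix with ones in the positions of the binary digits of `k`. -/
def digitProj (k : ℕ) : Matrix (Fin 5) (Fin 5) ℤ :=
  Matrix.diagonal fun m => if k.testBit (m : ℕ) then 1 else 0

theorem signMatrix_eq (k : ℕ) : signMatrix k = 1 - (2 : ℤ) • digitProj k := by
  ext a b
  rw [signMatrix, digitProj, Matrix.sub_apply, Matrix.smul_apply, Matrix.one_apply,
    Matrix.diagonal_apply, Matrix.diagonal_apply]
  split_ifs <;> simp

theorem isLorentzTwo_reflection (p : Fin 6) (s t : ℤˣ) :
    IsLorentzTwo (n := 4) (reflection (sideNormal p s t)) := by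
  refine ⟨?_, ⟨_, reflection_eq _⟩, ?_⟩
  · unfold PreservesForm
    revert p s t
    decide
  · revert p s t
    decide

theorem code_lt (c : Census) (p : Fin 6) : code c p < 16 := by
  cases c <;> revert p <;> decide

theorem isLorentzTwo_signMatrix {k : ℕ} (hk : k < 16) : IsLorentzTwo (n := 4) (signMatrix k) := by
  refine ⟨?_, ⟨_, signMatrix_eq _⟩, ?_⟩
  · unfold PreservesForm
    revert k
    decide
  · revert k
    decide

/-- For a reflection, `A` is `v vᵀ` modulo two: it has ones exactly at positions in `{a, b, 4}`. In
row `a` or `b` the diagonal entry cancels the one off-diagonal space entry, and the last sum returns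
the digit of the side. On a sign matrix only the diagonal term survives and returns the same digit.
-/
theorem holonomy_half_reflection_mul (c : Census) (p : Fin 6) (s t : ℤˣ) :
    holonomy c (half (reflection (sideNormal p s t) * signMatrix (code c p))) = 0 := by
  rw [half_mul ⟨_, reflection_eq _⟩ ⟨_, signMatrix_eq _⟩, half_eq (reflection_eq _),
    half_eq (signMatrix_eq _)]
  ext m
  rw [holonomy_apply]
  cases c <;> revert p s t m <;> decide

theorem mem_lorentzTwo_and_holonomy {c : Census} {g : GL (Fin 5) ℤ}
    (hg : g ∈ sidePairingGroup c) : g ∈ lorentzTwo 4 ∧ holonomy c (half g.1) = 0 := by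
  have h1 : sidePairingGroup c ≤
      ((AddMonoidHom.toMultiplicative (holonomy c)).comp (halfHom 4)).ker.map
        (lorentzTwo 4).subtype := by
    rw [sidePairingGroup, Subgroup.closure_le]
    rintro g ⟨p, s, t, h⟩
    have hmem : g ∈ lorentzTwo 4 := by
      change IsLorentzTwo _
      rw [h]
      exact (isLorentzTwo_reflection p s t).mul (isLorentzTwo_signMatrix (code_lt c p))
    refine ⟨⟨g, hmem⟩, ?_, rfl⟩
    change holonomy c (half g.1) = 0
    rw [h, holonomy_half_reflection_mul]
  obtain ⟨g', hg', rfl⟩ := h1 hg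
  exact ⟨g'.2, hg'⟩

/-! ### Sign changes normalise the side-pairing group -/

/-- The diagonal matrix of a vector of signs. -/
def signGL (d : Fin 5 → ℤˣ) : GL (Fin 5) ℤ where
  val := Matrix.diagonal fun i => (d i : ℤ)
  inv := Matrix.diagonal fun i => (d i : ℤ)
  val_inv := by
    rw [Matrix.diagonal_mul_diagonal, ← Matrix.diagonal_one]
    congr 1
    ext i
    exact Int.units_coe_mul_self _
  inv_val := by
    rw [Matrix.diagonal_mul_diagonal, ← Matrix.diagonal_one]
    congr 1
    ext i
    exact Int.units_coe_mul_self _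

theorem coe_signGL (d : Fin 5 → ℤˣ) : (signGL d).1 = Matrix.diagonal fun i => (d i : ℤ) := rfl

theorem signGL_mul_self (d : Fin 5 → ℤˣ) : signGL d * signGL d = 1 :=
  Units.ext (signGL d).inv_mul

theorem signGL_mul (d e : Fin 5 → ℤˣ) : signGL (d * e) = signGL d * signGL e := by
  refine Units.ext ?_
  rw [Units.val_mul, coe_signGL, coe_signGL, coe_signGL, Matrix.diagonal_mul_diagonal]
  simp

theorem diagonal_mul_reflection_mul_diagonal (d : Fin 5 → ℤˣ) (hd : d 4 = 1) (p : Fin 6)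
    (s t : ℤˣ) : (Matrix.diagonal fun i => (d i : ℤ)) * reflection (sideNormal p s t)
      * (Matrix.diagonal fun i => (d i : ℤ))
      = reflection (sideNormal p (d (pairs p).1 * s) (d (pairs p).2 * t)) := by
  have h1 : ∀ a, sideNormal p (d (pairs p).1 * s) (d (pairs p).2 * t) a
      = d a * sideNormal p s t a := by
    intro a
    simp only [sideNormal]
    split_ifs with h1 h2 h3
    · rw [h1]; simp
    · rw [h2]; simp
    · rw [h3, hd]; simp
    · simp
  ext a b
  rw [Matrix.mul_diagonal, Matrix.diagonal_mul, reflection, reflection, Matrix.of_apply,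
    Matrix.of_apply, h1, h1]
  have h2 : ((d a : ℤ)) * d a = 1 := Int.units_coe_mul_self _
  by_cases hab : a = b
  · subst hab
    simp only [if_true]
    split_ifs
    · linear_combination h2
    · linear_combination h2
  · simp only [hab, if_false]
    split_ifs <;> ring

/-- Conjugation changes the signs in the normal vector but keeps its pair of coordinates. The code
depends only on that pair and sign matrices commute, so the generators are permuted. -/
theorem signGL_conj_mem {c : Census} {d : Fin 5 → ℤˣ} (hd : d 4 = 1) {g : GL (Fin 5) ℤ}
    (hg : g ∈ sidePairingGroup c) : signGL d * g * signGL d ∈ sidePairingGroup c := by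
  have hi : (signGL d)⁻¹ = signGL d := inv_eq_of_mul_eq_one_left (signGL_mul_self d)
  have h : sidePairingGroup c ≤ (sidePairingGroup c).comap (MulAut.conj (signGL d)).toMonoidHom := by
    conv_lhs => rw [sidePairingGroup]
    rw [Subgroup.closure_le]
    rintro g ⟨p, s, t, h⟩
    refine Subgroup.subset_closure ⟨p, d (pairs p).1 * s, d (pairs p).2 * t, ?_⟩
    change (signGL d * g * (signGL d)⁻¹).1 = _
    rw [hi, Units.val_mul, Units.val_mul, h, ← diagonal_mul_reflection_mul_diagonal d hd,
      coe_signGL, signMatrix]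
    simp only [Matrix.mul_assoc]
    congr 2
    rw [Matrix.diagonal_mul_diagonal, Matrix.diagonal_mul_diagonal]
    congr 1
    ext i
    ring
  have h1 : signGL d * g * (signGL d)⁻¹ ∈ sidePairingGroup c := h hg
  rwa [hi] at h1

/-- The signs of a digit. -/
def digitSigns (k : ℕ) (m : Fin 5) : ℤˣ := if k.testBit (m : ℕ) then -1 else 1

theorem coe_signGL_digitSigns (k : ℕ) : (signGL (digitSigns k)).1 = signMatrix k := by
  rw [coe_signGL, signMatrix]
  congr 1
  ext m
  rw [digitSigns]
  split_ifs <;> simp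

/-- The pairs of coordinates of a coordinate hyperplane. -/
def hyperplanePair : Fin 4 → Fin 3 → Fin 6 := ![![2, 4, 5], ![1, 3, 5], ![0, 3, 4], ![0, 1, 2]]

theorem block_wallProj_sign (j : Fin 4) (i : Fin 3) :
    block j (1 - (2 : ℤ) • wallProj (Fin.castAdd 3 i)) 1 =
      Matrix.diagonal fun m => ((if m = j.castSucc.succAbove i.castSucc then -1 else 1 : ℤˣ) : ℤ) := by
  revert i j
  decide

theorem block_wallProj_side (j : Fin 4) (i : Fin 3) :
    block j (1 - (2 : ℤ) • wallProj (Fin.natAdd 3 i)) 1 =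
      reflection (sideNormal (hyperplanePair j i) 1 1) := by
  revert i j
  decide

/-- Induction over the generating reflections. Coordinate walls are sign changes, absorbed into `d`;
the other walls come from sides of the 24-cell orthogonal to the hyperplane, whose side-pairings
differ from the reflections by sign changes. Sign changes move past earlier factors because they
normalise the side-pairing group. -/
theorem exists_blockHom_mul_signGL_mem (c : Census) (j : Fin 4) (g : lorentzTwo 3) :
    ∃ d : Fin 5 → ℤˣ, d 4 = 1 ∧ blockHom j g.1 * signGL d ∈ sidePairingGroup c := by
  induction g using lorentzTwo_induction with
  | one => exact ⟨1, rfl, by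
      have : signGL 1 = 1 := Units.ext (by simp [coe_signGL])
      simp [this]⟩
  | mul i g ih =>
    obtain ⟨d, hd, h⟩ := ih
    induction i using Fin.addCases (m := 3) (n := 3) with
    | left i =>
      set s : Fin 5 → ℤˣ := fun m => if m = j.castSucc.succAbove i.castSucc then -1 else 1 with hs
      have hs4 : s 4 = 1 := by
        rw [hs]
        exact if_neg ((by decide : ∀ (j : Fin 4) (i : Fin 3),
          (4 : Fin 5) ≠ j.castSucc.succAbove i.castSucc) j i)
      refine ⟨d * s, by simp [hd, hs4], ?_⟩
      have h1 : blockHom j (wallRefl (Fin.castAdd 3 i)).1 = signGL s :=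
        Units.ext (block_wallProj_sign j i)
      rw [Subgroup.coe_mul, map_mul, h1, signGL_mul, ← mul_assoc, mul_assoc (signGL s)]
      exact signGL_conj_mem hs4 h
    | right i =>
      set k := code c (hyperplanePair j i) with hk
      have hk4 : digitSigns k 4 = 1 := by
        have := code_lt c (hyperplanePair j i)
        rw [← hk] at this
        generalize k = k at this
        revert k
        decide
      refine ⟨d * digitSigns k, by simp [hd, hk4], ?_⟩
      have h1 : blockHom j (wallRefl (Fin.natAdd 3 i)).1 * signGL (digitSigns k)
          ∈ sidePairingGroup c := by
        refine Subgroup.subset_closure ⟨hyperplanePair j i, 1, 1, ?_⟩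
        rw [Units.val_mul, coe_signGL_digitSigns, ← block_wallProj_side j i]
        rfl
      have h2 := mul_mem h1 (signGL_conj_mem hk4 h)
      have h3 : blockHom j (wallRefl (Fin.natAdd 3 i) * g).1 * signGL (d * digitSigns k)
          = blockHom j (wallRefl (Fin.natAdd 3 i)).1 * signGL (digitSigns k) *
            (signGL (digitSigns k) * (blockHom j g.1 * signGL d) * signGL (digitSigns k)) := by
        rw [Subgroup.coe_mul, map_mul, signGL_mul]
        simp only [mul_assoc]
        rw [← mul_assoc (signGL (digitSigns k)) (signGL (digitSigns k)), signGL_mul_self, one_mul]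
      rwa [h3]

/-! ### The stabiliser of a coordinate hyperplane -/

/-- The holonomy of the reduction of an isometry of the `j`-th coordinate hyperplane, up to the
sign change of the `j`-th coordinate. -/
def crossHolonomy (c : Census) (j : Fin 4) :
    Matrix (Fin 4) (Fin 4) (ZMod 2) →+ ({m : Fin 4 // m ≠ j} → ZMod 2) where
  toFun A m := holonomy c (block j A 0) m
  map_zero' := by
    have : block j (0 : Matrix (Fin 4) (Fin 4) (ZMod 2)) 0 = 0 := by
      apply ext_block j <;> intros <;> simp
    ext m
    simp [this]
  map_add' A B := by
    ext m
    have := block_add j A B 0 0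
    rw [add_zero] at this
    rw [← this, map_add]
    rfl

/-- The entry `e` enters only the `j`-th component of the holonomy. -/
theorem holonomy_block (c : Census) {j m : Fin 4} (hm : m ≠ j) (A : Matrix (Fin 4) (Fin 4) (ZMod 2))
    (e : ZMod 2) : holonomy c (block j A e) m = crossHolonomy c j A ⟨m, hm⟩ := by
  have h : ∀ a b : Fin 5, ¬ (a = j.castSucc ∧ b = j.castSucc) →
      block j A e a b = block j A 0 a b := by
    intro a b hab
    induction a using Fin.succAboveCases j.castSucc with
    | x =>
      induction b using Fin.succAboveCases j.castSucc with
      | x => simp at hab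
      | p b => simp
    | p a =>
      induction b using Fin.succAboveCases j.castSucc with
      | x => simp
      | p b => simp
  have hm' : m.castSucc ≠ j.castSucc := fun h => hm (Fin.castSucc_injective _ h)
  change _ = holonomy c (block j A 0) m
  rw [holonomy_apply, holonomy_apply, h _ _ fun h => hm' h.1]
  congr 2
  · refine Finset.sum_congr rfl fun b _ => ?_
    rw [h _ _ fun h => hm' h.1]
  · funext p
    rw [h]
    rintro ⟨h1, h2⟩
    exact (by decide : ∀ p, (pairs p).1 ≠ (pairs p).2) p (h1.trans h2.symm)

/-- The sign changes of an isometry of the `j`-th coordinate hyperplane, as a homomorphism. -/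
def crossHom (c : Census) (j : Fin 4) :
    lorentzTwo 3 →* Multiplicative ({m : Fin 4 // m ≠ j} → ZMod 2) :=
  (AddMonoidHom.toMultiplicative (crossHolonomy c j)).comp (halfHom 3)

theorem mem_ker_crossHom {c : Census} {j : Fin 4} {g : lorentzTwo 3} :
    g ∈ (crossHom c j).ker ↔ crossHolonomy c j (half g.1.1) = 0 := Iff.rfl

theorem signGL_eq_one_sub (d : Fin 5 → ℤˣ) : (signGL d).1
    = 1 - (2 : ℤ) • Matrix.diagonal (fun i => if d i = 1 then 0 else 1) := by
  ext a b
  rw [coe_signGL, Matrix.sub_apply, Matrix.smul_apply, Matrix.one_apply,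
    Matrix.diagonal_apply, Matrix.diagonal_apply]
  rcases Int.units_eq_one_or (d a) with h | h <;> split_ifs <;> simp_all

theorem holonomy_signGL (c : Census) (d : Fin 5 → ℤˣ) (m : Fin 4) :
    holonomy c (half (signGL d).1) m = if d m.castSucc = 1 then 0 else 1 := by
  rw [half_eq (signGL_eq_one_sub d), holonomy_apply, Finset.sum_eq_zero, Finset.sum_eq_zero]
  · simp
  · intro p _
    have : (pairs p).1 ≠ (pairs p).2 := by revert p; decide
    simp [this]
  · intro b _
    split_ifs with hb
    · rfl
    · simp [Fin.castSucc_inj, Ne.symm hb]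

/-- An isometry of the coordinate hyperplane with trivial sign changes extends to an element
of the side-pairing group. -/
theorem exists_mem_sidePairingGroup {c : Census} {j : Fin 4} {g : lorentzTwo 3}
    (hg : g ∈ (crossHom c j).ker) : ∃ h ∈ sidePairingGroup c, ∃ e : ℤˣ, h.1 = block j g.1.1 e := by
  obtain ⟨d, hd, h⟩ := exists_blockHom_mul_signGL_mem c j g
  refine ⟨_, h, d j.castSucc, ?_⟩
  obtain ⟨A, hA⟩ := (isLorentzTwo g.2).congr
  have hb : (blockHom j g.1).1 = 1 - (2 : ℤ) • block j A 0 := by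
    rw [coe_blockHom, hA, ← block_one_sub, mul_zero, sub_zero]
  have h1 := (mem_lorentzTwo_and_holonomy h).2
  rw [Units.val_mul, half_mul ⟨_, hb⟩ ⟨_, signGL_eq_one_sub d⟩, map_add, coe_blockHom,
    half_block] at h1
  -- The lift has trivial holonomy and so has `g` away from `j`, so the correcting signs can only
  -- affect the `j`-th coordinate.
  have h2 : ∀ m : Fin 4, m ≠ j → d m.castSucc = 1 := by
    intro m hm
    have h3 := congrFun h1 m
    rw [Pi.add_apply, holonomy_block c hm, holonomy_signGL, mem_ker_crossHom.1 hg] at h3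
    by_contra h4
    simp [h4] at h3
  have h3 : (signGL d).1 = block j 1 (d j.castSucc : ℤ) := by
    have h4 : ∀ a : Fin 4, d (j.castSucc.succAbove a) = 1 := by
      intro a
      induction a using Fin.lastCases with
      | last => rw [← hd, ← last_eq_succAbove]; rfl
      | cast a =>
        rw [Fin.castSucc_succAbove_castSucc]
        exact h2 _ (Fin.succAbove_ne _ _)
    rw [coe_signGL]
    apply ext_block j <;> intros <;>
      simp [Matrix.diagonal_apply, Matrix.one_apply, h4, (Fin.succAbove_ne _ _).symm]
  rw [Units.val_mul, h3, coe_blockHom, block_mul, one_mul, mul_one]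

/-- An integral matrix that preserves the `j`-th coordinate hyperplane is a block matrix. -/
theorem PreservesHyperplane.eq_block {j : Fin 4} {g : GL (Fin 5) ℤ} (hg : g ∈ lorentzTwo 4)
    (h : PreservesHyperplane j g) :
    g.1 = block j (g.1.submatrix j.castSucc.succAbove j.castSucc.succAbove)
      (g.1 j.castSucc j.castSucc) := by
  have hi : (g⁻¹).1 = gram 4 * (g.1)ᵀ * gram 4 :=
    Units.inv_eq_of_mul_eq_one_left (PreservesForm.inverse_mul (isLorentzTwo hg).form)
  apply ext_block j
  · simp
  · intro b
    rw [h.apply_eq_zero (Fin.succAbove_ne _ _), block_same_succAbove]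
  · intro a
    -- The inverse is the transpose up to signs, so the vanishing row of the inverse gives the
    -- vanishing column of `g`.
    have h1 := h.inv.apply_eq_zero (i := j.castSucc.succAbove a) (Fin.succAbove_ne _ _)
    rw [hi, gram, Matrix.mul_diagonal, Matrix.diagonal_mul] at h1
    rw [block_succAbove_same]
    split_ifs at h1 <;> simpa using h1
  · intro a b
    simp

/-- The restriction of an element of the side-pairing group to a coordinate hyperplane that it
preserves has trivial sign changes. -/
theorem exists_restriction {c : Census} {j : Fin 4} {h : GL (Fin 5) ℤ}
    (hh : h ∈ sidePairingGroup c) (hp : PreservesHyperplane j h) :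
    ∃ g ∈ (crossHom c j).ker, ∃ e : ℤ, h.1 = block j g.1.1 e := by
  obtain ⟨hL, h0⟩ := mem_lorentzTwo_and_holonomy hh
  have hb := hp.eq_block hL
  set e := h.1 j.castSucc j.castSucc
  set A := h.1.submatrix j.castSucc.succAbove j.castSucc.succAbove
  have hA : IsLorentzTwo (n := 3) A := isLorentzTwo_of_block (hb ▸ isLorentzTwo hL)
  have hAi := hA.form.inverse_mul
  refine ⟨⟨⟨A, _, mul_eq_one_comm.1 hAi, hAi⟩, hA⟩, ?_, e, hb⟩
  rw [mem_ker_crossHom]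
  rw [hb, half_block] at h0
  funext m
  exact (holonomy_block c m.2 _ _).symm.trans (congrFun h0 m)

theorem hyperplaneDet_eq {j : Fin 4} {h : GL (Fin 5) ℤ} {A : Matrix (Fin 4) (Fin 4) ℤ} {e : ℤ}
    (hb : h.1 = block j A e) : hyperplaneDet j h = A.det := by
  rw [hyperplaneDet]
  congr 1
  ext a b
  rw [Matrix.submatrix_apply, hb, block_succAbove_succAbove]

theorem preservesHyperplane_of_block {j : Fin 4} {h : GL (Fin 5) ℤ}
    {A : Matrix (Fin 4) (Fin 4) ℤ} {e : ℤ} (he : e ≠ 0) (hb : h.1 = block j A e) :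
    PreservesHyperplane j h := by
  intro z
  have : act h z j.castSucc = e * z j.castSucc := by
    rw [act, hb, Matrix.mulVec, dotProduct, Fin.sum_univ_succAbove _ j.castSucc]
    simp
  simp [this, he]

/-! ### The action on a coordinate hyperplane is free -/

/-- The reduction modulo four of a product of reflections. -/
theorem exists_half_eq_sum (g : lorentzTwo 3) :
    ∃ t : Fin 6 → ZMod 2, half g.1.1 = ∑ i, t i • (wallProj i).map (Int.cast : ℤ → ZMod 2) := by
  induction g using lorentzTwo_induction with
  | one => exact ⟨0, by simpa using half_one⟩
  | mul i g ih =>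
    obtain ⟨t, ht⟩ := ih
    refine ⟨Pi.single i 1 + t, ?_⟩
    have := half_mul (isLorentzTwo (wallRefl i).2).congr (isLorentzTwo g.2).congr
    rw [Subgroup.coe_mul, Units.val_mul, this, ht, half_wallRefl]
    simp only [Pi.add_apply, add_smul, Finset.sum_add_distrib]
    congr 1
    rw [Finset.sum_eq_single i]
    · simp
    · intro k _ hk
      simp [hk]
    · simp

/-- A linear combination of the six rank one matrices of the walls. -/
def wallSum (t : Fin 6 → ZMod 2) : Matrix (Fin 4) (Fin 4) (ZMod 2) :=
  ∑ i, t i • (wallProj i).map (Int.cast : ℤ → ZMod 2)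

/-- The finite check behind freeness: among the 64 combinations, every idempotent with nonzero
coefficients is detected by the sign changes of each of the four codes. -/
theorem wallSum_eq_zero (t : Fin 6 → ZMod 2) (h : wallSum t * wallSum t = wallSum t) (c : Census)
    (j : Fin 4) (hc : crossHolonomy c j (wallSum t) = 0) : wallSum t = 0 := by
  have key : ∀ t : Fin 6 → ZMod 2, wallSum t * wallSum t = wallSum t → t ≠ 0 →
      ∀ j, ∃ m, crossHolonomy c j (wallSum t) m ≠ 0 := by
    cases c <;> decide +kernel
  by_contra h0
  obtain ⟨m, hm⟩ := key t h (fun ht => h0 (by simp [wallSum, ht])) j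
  exact hm (congrFun hc m)

/-- An isometry of a coordinate hyperplane with trivial sign changes and a fixed point is
trivial. -/
theorem eq_one_of_smul_eq {c : Census} {j : Fin 4} {g : lorentzTwo 3}
    (hg : g ∈ (crossHom c j).ker) {x : Hyp 3} (h : g • x = x) : g = 1 := by
  obtain ⟨A, hA⟩ := (isLorentzTwo g.2).congr
  have h1 := congrArg (fun z : lorentzTwo 3 => z.1.1) (sq_eq_one_of_smul_eq h)
  have hAA : A * A = A := by
    rw [pow_two] at h1
    change g.1.1 * g.1.1 = 1 at h1
    rw [hA] at h1
    have h2 : (4 : ℤ) • (A * A - A) = 0 := by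
      rw [← sub_eq_zero] at h1
      rw [← h1]
      simp only [sub_mul, mul_sub, smul_mul_assoc, mul_smul_comm, one_mul, mul_one, smul_sub,
        smul_smul]
      rw [show (4 : ℤ) = 2 + 2 by norm_num, show (2 : ℤ) * 2 = 2 + 2 by norm_num]
      simp only [add_smul]
      abel
    rw [smul_eq_zero_iff_right (by norm_num)] at h2
    exact sub_eq_zero.1 h2
  have h2 : half g.1.1 = A.map (Int.castRingHom (ZMod 2)) := half_eq hA
  obtain ⟨t, ht⟩ := exists_half_eq_sum g
  have h3 : half g.1.1 = 0 := by
    have h4 : half g.1.1 * half g.1.1 = half g.1.1 := by rw [h2, ← Matrix.map_mul, hAA]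
    rw [mem_ker_crossHom] at hg
    rw [ht] at h4 hg ⊢
    exact wallSum_eq_zero t h4 c j hg
  rw [h2] at h3
  obtain ⟨B, hB⟩ : ∃ B : Matrix (Fin 4) (Fin 4) ℤ, A = (2 : ℤ) • B := by
    have h4 : ∀ i k, (2 : ℤ) ∣ A i k := by
      intro i k
      have := congrFun (congrFun h3 i) k
      exact (ZMod.intCast_zmod_eq_zero_iff_dvd _ 2).1 this
    choose B hB using h4
    exact ⟨Matrix.of B, by ext i k; rw [hB]; simp [-zsmul_eq_mul]⟩
  have h5 : B = 0 := by
    refine eq_zero_of_eq_smul_sq (e := 1) ?_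
    rw [hB, smul_mul_smul_comm, mul_smul] at hAA
    rw [mul_one]
    exact (smul_right_injective _ (two_ne_zero) hAA).symm
  exact Subtype.ext (Units.ext (by rw [hA, hB, h5]; simp))

/-! ### Coordinate hyperplanes as copies of hyperbolic three-space -/

theorem lorentz_split (j : Fin 4) (x y : Fin 5 → ℝ) :
    lorentz x y = x j.castSucc * y j.castSucc +
      minkowski (n := 3) (fun i => x (j.castSucc.succAbove i))
        (fun i => y (j.castSucc.succAbove i)) := by
  rw [lorentz, minkowski, Fin.sum_univ_succAbove _ j, ← last_eq_succAbove]
  simp only [← Fin.castSucc_succAbove_castSucc]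
  rw [add_sub_assoc]
  rfl

/-- The coordinate hyperplane is a copy of hyperbolic three-space. -/
def hyperplaneHomeo (j : Fin 4) : Hyp 3 ≃ₜ Hyperplane j where
  toFun x := ⟨⟨Fin.insertNth (α := fun _ => ℝ) j.castSucc 0 x.1, by
    constructor
    · rw [lorentz_split j]
      simpa using x.2.1
    · have h := last_eq_succAbove j
      change (4 : Fin 5) = _ at h
      rw [h, Fin.insertNth_apply_succAbove]
      exact x.2.2⟩, by simp⟩
  invFun x := ⟨fun i => x.1.1 (j.castSucc.succAbove i), by
    constructor
    · have h := x.1.2.1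
      rwa [lorentz_split j, x.2, zero_mul, zero_add] at h
    · have h : 0 < x.1.1 (Fin.last 4) := x.1.2.2
      rwa [last_eq_succAbove j] at h⟩
  left_inv x := by
    ext i
    simp
  right_inv x := by
    refine Subtype.ext (Subtype.ext (funext fun i => ?_))
    induction i using Fin.succAboveCases j.castSucc with
    | x => simp [x.2]
    | p i => simp
  continuous_toFun := by
    refine Continuous.subtype_mk (Continuous.subtype_mk ?_ _) _
    exact Continuous.finInsertNth _ continuous_const continuous_subtype_val
  continuous_invFun := by
    refine Continuous.subtype_mk (continuous_pi fun i => ?_) _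
    exact (continuous_apply _).comp (continuous_subtype_val.comp continuous_subtype_val)

theorem hyperplaneHomeo_apply_succAbove (j : Fin 4) (x : Hyp 3) (i : Fin 4) :
    (hyperplaneHomeo j x).1.1 (j.castSucc.succAbove i) = x.1 i :=
  Fin.insertNth_apply_succAbove (α := fun _ => ℝ) _ _ _ _

theorem act_hyperplaneHomeo {j : Fin 4} {h : GL (Fin 5) ℤ} {g : lorentzTwo 3} {e : ℤ}
    (hb : h.1 = block j g.1.1 e) (x : Hyp 3) :
    act h (hyperplaneHomeo j x).1.1 = (hyperplaneHomeo j (g • x)).1.1 := by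
  ext i
  rw [act, hb, Matrix.mulVec, dotProduct, Fin.sum_univ_succAbove _ j.castSucc]
  rw [(hyperplaneHomeo j x).2]
  simp only [hyperplaneHomeo_apply_succAbove]
  induction i using Fin.succAboveCases j.castSucc with
  | x => simp [(hyperplaneHomeo j (g • x)).2]
  | p i =>
    rw [hyperplaneHomeo_apply_succAbove, coe_smul, linAct_apply]
    simp

/-- This replaces the stabiliser in the side-pairing group by the kernel of `crossHom`; restriction
and extension of isometries give the two directions. -/
theorem orientationCover_mk_eq_iff (c : Census) (j : Fin 4) (x y : Hyp 3) (u v : ℤˣ) :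
    (Quotient.mk (orientationSetoid c j) (hyperplaneHomeo j x, u)
      = Quotient.mk (orientationSetoid c j) (hyperplaneHomeo j y, v)) ↔
    ∃ g ∈ (crossHom c j).ker, g • x = y ∧ g.1.1.det * (u : ℤ) = v := by
  constructor
  · intro h
    obtain ⟨h, hh, hp, hact, hdet⟩ := Quotient.exact h
    obtain ⟨g, hg, e, hb⟩ := exists_restriction hh hp
    refine ⟨g, hg, ?_, ?_⟩
    · apply (hyperplaneHomeo j).injective
      refine Subtype.ext (Subtype.ext ?_)
      rw [← act_hyperplaneHomeo hb]
      exact hact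
    · rw [← hyperplaneDet_eq hb]
      exact hdet
  · rintro ⟨g, hg, rfl, hdet⟩
    obtain ⟨h, hh, e, hb⟩ := exists_mem_sidePairingGroup hg
    refine Quotient.sound ⟨h, hh, preservesHyperplane_of_block e.ne_zero hb,
      act_hyperplaneHomeo hb x, ?_⟩
    rw [hyperplaneDet_eq hb]
    exact hdet

/-! ### Non-orientable cross-sections have orientation-reversing deck transformations -/

/-- Expanding the last hypothesis gives `b² ≤ 2abts`. As `4|s|t < 1`, this yields `2|b| < |a|` if `b
≠ 0`, hence `4b² < a² ≤ 1 + b²`, impossible for an integer `b ≠ 0`. -/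
theorem eq_zero_of_close {a b : ℤ} {s t : ℝ} (ha : 1 ≤ a ^ 2) (hab : a ^ 2 ≤ 1 + b ^ 2)
    (hst : 0 ≤ t ^ 2 - 1 - s ^ 2) (ht : 0 < t) (hs : 4 * |s| * t < 1)
    (h : (b * t - a * s) ^ 2 ≤ (1 + (b : ℝ) ^ 2 - a ^ 2) * (t ^ 2 - 1 - s ^ 2)) : b = 0 := by
  by_contra hb
  have ha' : (1 : ℝ) ≤ (a : ℝ) ^ 2 := by exact_mod_cast ha
  have h1 : (b : ℝ) ^ 2 ≤ 2 * (a * b * t * s) := by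
    nlinarith [sq_nonneg ((b : ℝ) * s), sq_nonneg ((a : ℝ) * s), sq_nonneg (b : ℝ)]
  have h2 : (a : ℝ) * b * t * s ≤ |(a : ℝ)| * |(b : ℝ)| * (|s| * t) := by
    refine (le_abs_self _).trans (le_of_eq ?_)
    rw [abs_mul, abs_mul, abs_mul, abs_of_pos ht]
    ring
  have hb0 : 0 < |(b : ℝ)| := by positivity
  have ha0 : 0 < |(a : ℝ)| := by
    rw [abs_pos]
    intro h0
    rw [h0] at ha'
    norm_num at ha'
  have h3 : |(a : ℝ)| * |(b : ℝ)| * (|s| * t) < |(a : ℝ)| * |(b : ℝ)| * (1 / 4) := by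
    refine mul_lt_mul_of_pos_left (by linarith) (by positivity)
  have h4 : 2 * |(b : ℝ)| < |(a : ℝ)| := by
    rw [← sq_abs (b : ℝ)] at h1
    nlinarith
  have h5 : 4 * (b : ℝ) ^ 2 < (a : ℝ) ^ 2 := by
    rw [← sq_abs (b : ℝ), ← sq_abs (a : ℝ)]
    nlinarith
  have h6 : 4 * b ^ 2 < a ^ 2 := by exact_mod_cast h5
  have h7 : 0 < b ^ 2 := by positivity
  nlinarith

/-- A translate of the hyperplane either coincides with it or stays away from it. The normal `w = h
e_j` of the translate is orthogonal to `z`; applying Cauchy–Schwarz to the coordinates other than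
`j` and time forces `w 4 = 0`. Then `w` is an integral unit vector with odd `j`-th entry, so `w = ±
e_j`. -/
theorem preservesHyperplane_of_close {j : Fin 4} {h : GL (Fin 5) ℤ} (hh : h ∈ lorentzTwo 4)
    {x z : HypFour} (hx : x.1 j.castSucc = 0) (hz : act h x.1 = z.1)
    (hclose : 4 * |z.1 j.castSucc| * z.1 4 < 1) : PreservesHyperplane j h := by
  set w : Fin 5 → ℤ := fun i => h.1 i j.castSucc with hw
  have hform := (isLorentzTwo hh).form
  have hsingle : act h (Pi.single j.castSucc 1) = fun i => (w i : ℝ) := by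
    ext i
    simp [act, hw, Matrix.mulVec, dotProduct, Pi.single_apply]
  have hmin : ∀ u v, lorentz (act h u) (act h v) = lorentz u v := minkowski_linAct hform
  have hdual : ∀ v : Fin 5 → ℝ, lorentz (Pi.single j.castSucc 1) v = v j.castSucc := by
    intro v
    have h4 : (4 : Fin 5) ≠ j.castSucc := (Fin.castSucc_ne_last j).symm
    simp [lorentz, Pi.single_apply, h4]
  have hwz : lorentz (fun i => (w i : ℝ)) z.1 = 0 := by
    rw [← hsingle, ← hz, hmin, hdual, hx]
  have hww : ∑ i : Fin 4, w i.castSucc * w i.castSucc - w 4 * w 4 = 1 := by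
    have := transpose_mul_gram_mul_apply h.1 j.castSucc j.castSucc
    rw [show h.1ᵀ * gram 4 * h.1 = gram 4 from hform] at this
    rw [hw]
    refine this.symm.trans ?_
    have h4 : j.castSucc ≠ (4 : Fin 5) := Fin.castSucc_ne_last j
    simp [gram, h4]
  have hodd : w j.castSucc ≠ 0 := by
    obtain ⟨A, hA⟩ := (isLorentzTwo hh).congr
    have : w j.castSucc = 1 - 2 * A j.castSucc j.castSucc := by
      rw [hw]
      simp [hA, -zsmul_eq_mul]
    omega
  rw [Fin.sum_univ_succAbove _ j] at hww
  have hzz := z.2.1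
  rw [lorentz, Fin.sum_univ_succAbove _ j] at hwz hzz
  have hwwR : (∑ i : Fin 3, (w (j.succAbove i).castSucc : ℝ) ^ 2)
      = 1 + (w 4 : ℝ) ^ 2 - (w j.castSucc : ℝ) ^ 2 := by
    have : ∑ i : Fin 3, w (j.succAbove i).castSucc ^ 2 = 1 + w 4 ^ 2 - w j.castSucc ^ 2 := by
      simp only [pow_two]
      linarith
    exact_mod_cast this
  have hzzR : (∑ i : Fin 3, (z.1 (j.succAbove i).castSucc) ^ 2)
      = z.1 4 ^ 2 - 1 - z.1 j.castSucc ^ 2 := by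
    simp only [pow_two]
    linarith
  have hcs := Finset.sum_mul_sq_le_sq_mul_sq Finset.univ
    (fun i : Fin 3 => (w (j.succAbove i).castSucc : ℝ)) (fun i => z.1 (j.succAbove i).castSucc)
  rw [hwwR, hzzR, show ∑ i : Fin 3, (w (j.succAbove i).castSucc : ℝ) * z.1 (j.succAbove i).castSucc
    = w 4 * z.1 4 - w j.castSucc * z.1 j.castSucc by linarith] at hcs
  have hw1 : 1 ≤ w j.castSucc ^ 2 := by
    have : 0 < w j.castSucc ^ 2 := by positivity
    omega
  have hw2 : w j.castSucc ^ 2 ≤ 1 + w 4 ^ 2 := by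
    have : 0 ≤ ∑ i : Fin 3, w (j.succAbove i).castSucc * w (j.succAbove i).castSucc :=
      Finset.sum_nonneg fun i _ => mul_self_nonneg _
    nlinarith
  have hw4 : w 4 = 0 := by
    refine eq_zero_of_close hw1 hw2 ?_ z.2.2 hclose hcs
    rw [← hzzR]
    exact Finset.sum_nonneg fun i _ => sq_nonneg _
  have hws : ∀ i : Fin 3, w (j.succAbove i).castSucc = 0 := by
    have h0 : ∑ i : Fin 3, w (j.succAbove i).castSucc * w (j.succAbove i).castSucc ≤ 0 := by
      rw [hw4] at hww
      nlinarith
    intro i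
    have h1 := (Finset.single_le_sum (fun i _ => mul_self_nonneg (w (j.succAbove i).castSucc))
      (Finset.mem_univ i)).trans h0
    exact mul_self_eq_zero.1 (le_antisymm h1 (mul_self_nonneg _))
  have hinv : PreservesHyperplane j h⁻¹ := by
    intro v
    have h1 : act h (act h⁻¹ v) = v := by rw [← act_mul, mul_inv_cancel, act_one]
    have h2 : act h⁻¹ v j.castSucc = w j.castSucc * v j.castSucc := by
      rw [← hdual (act h⁻¹ v), ← hmin, hsingle, h1, lorentz, Fin.sum_univ_succAbove _ j]
      simp [hw4, hws]
    rw [h2]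
    simp [hodd]
  simpa using hinv.inv

/-- The action of an isometry on hyperbolic four-space. -/
def actHyp {g : GL (Fin 5) ℤ} (hg : g ∈ lorentzTwo 4) (x : HypFour) : HypFour :=
  ⟨act g x.1, linAct_mem (n := 4) hg x⟩

theorem continuous_actHyp {g : GL (Fin 5) ℤ} (hg : g ∈ lorentzTwo 4) : Continuous (actHyp hg) :=
  ((continuous_linAct g).comp continuous_subtype_val).subtype_mk _

theorem isOpenMap_fourManifold_mk (c : Census) :
    IsOpenMap (Quotient.mk (orbitSetoid c)) := by
  intro U hU
  refine isOpen_coinduced.2 ?_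
  have h : Quotient.mk (orbitSetoid c) ⁻¹' (Quotient.mk (orbitSetoid c) '' U) =
      ⋃ g : sidePairingGroup c, actHyp (mem_lorentzTwo_and_holonomy g.2).1 ⁻¹' U := by
    ext x
    simp only [Set.mem_preimage, Set.mem_image, Set.mem_iUnion]
    constructor
    · rintro ⟨y, hy, hxy⟩
      obtain ⟨g, hg, hgy⟩ := Quotient.exact hxy.symm
      refine ⟨⟨g, hg⟩, ?_⟩
      convert hy
      exact Subtype.ext hgy
    · rintro ⟨g, hg⟩
      exact ⟨_, hg, Quotient.sound ((orbitSetoid c).symm ⟨g.1, g.2, rfl⟩)⟩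
  change IsOpen (Quotient.mk (orbitSetoid c) ⁻¹' _)
  rw [h]
  exact isOpen_iUnion fun g => hU.preimage (continuous_actHyp _)

/-- A continuous map from hyperbolic four-space to a coordinate hyperplane that fixes the points of
this hyperplane. -/
noncomputable def retraction (j : Fin 4) (z : HypFour) : Hyperplane j :=
  hyperplaneHomeo j (lift fun i => z.1 (j.castSucc.succAbove i.castSucc))

theorem continuous_retraction (j : Fin 4) : Continuous (retraction j) := by
  refine (hyperplaneHomeo j).continuous.comp ((spaceHomeo 3).symm.continuous.comp ?_)
  exact continuous_pi fun i => (continuous_apply _).comp continuous_subtype_val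

theorem retraction_coe {j : Fin 4} (x : Hyperplane j) : retraction j x.1 = x := by
  obtain ⟨y, rfl⟩ := (hyperplaneHomeo j).surjective x
  rw [retraction]
  congr 1
  refine Eq.trans ?_ ((spaceHomeo 3).symm_apply_apply y)
  simp only [hyperplaneHomeo_apply_succAbove]
  rfl

/-- The standard orientation of the hyperplane descends to the cross-section. It is well defined
because an element identifying two points of the hyperplane preserves it; continuity in the subspace
topology needs the quantitative form of that fact in `preservesHyperplane_of_close`. -/
theorem orientable_of_det_eq_one {c : Census} {j : Fin 4}
    (h : ∀ g ∈ (crossHom c j).ker, g.1.1.det = 1) : CrossSectionOrientable c j := by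
  have hsame : ∀ x y : Hyperplane j, Quotient.mk (orbitSetoid c) x.1 = Quotient.mk _ y.1 →
      Quotient.mk (orientationSetoid c j) (x, 1) = Quotient.mk _ (y, 1) := by
    intro x y hxy
    obtain ⟨g, hg, hact⟩ := Quotient.exact hxy
    have hp : PreservesHyperplane j g :=
      preservesHyperplane_of_close (mem_lorentzTwo_and_holonomy hg).1 x.2 hact (by simp [y.2])
    obtain ⟨g', hg', e, hb⟩ := exists_restriction hg hp
    refine Quotient.sound ⟨g, hg, hp, hact, ?_⟩
    rw [hyperplaneDet_eq hb, h g' hg']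
    rfl
  refine ⟨fun y => Quotient.mk _ (y.2.choose, 1), ?_, fun y => Subtype.ext y.2.choose_spec⟩
  set s : crossSection c j → OrientationCover c j := fun y => Quotient.mk _ (y.2.choose, 1) with hs
  have hspec : ∀ (y : crossSection c j) (x : Hyperplane j), Quotient.mk (orbitSetoid c) x.1 = y.1 →
      s y = Quotient.mk _ (x, 1) := fun y x hx => hsame _ _ (y.2.choose_spec.trans hx.symm)
  set q : HypFour → FourManifold c := Quotient.mk (orbitSetoid c) with hq
  -- The cross-section has the subspace topology, so continuity is tested on its full preimage in
  -- hyperbolic four-space, which contains all translates of the hyperplane.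
  have hr : Topology.IsQuotientMap ((crossSection c j).restrictPreimage q) :=
    ((isOpenMap_fourManifold_mk c).restrictPreimage _).isQuotientMap
      (continuous_quotient_mk'.restrictPreimage)
      (Set.restrictPreimage_surjective _ Quotient.mk_surjective)
  rw [hr.continuous_iff, continuous_iff_continuousAt]
  intro z₀
  obtain ⟨x₀, hx₀⟩ := z₀.2
  obtain ⟨g, hg, hgz⟩ := Quotient.exact hx₀.symm
  -- Translating by `g` puts `z₀` on the hyperplane. Nearby points of the preimage then land on the
  -- hyperplane too, where the retraction is the identity and the section is visibly continuous.
  set Z : q ⁻¹' crossSection c j → HypFour :=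
    fun z => actHyp (mem_lorentzTwo_and_holonomy hg).1 z.1 with hZ
  have hZc : Continuous Z := (continuous_actHyp _).comp continuous_subtype_val
  have hev : ∀ᶠ z in nhds z₀, 4 * |(Z z).1 j.castSucc| * (Z z).1 4 < 1 := by
    refine ContinuousAt.eventually_lt (Continuous.continuousAt ?_) continuousAt_const ?_
    · have h1 : ∀ i, Continuous fun z => (Z z).1 i := fun i =>
        (continuous_apply _).comp (continuous_subtype_val.comp hZc)
      exact (continuous_const.mul (h1 _).abs).mul (h1 _)
    · have : (Z z₀).1 = x₀.1.1 := hgz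
      rw [this, x₀.2]
      simp
  have hcont : Continuous fun z => Quotient.mk (orientationSetoid c j) (retraction j (Z z), 1) :=
    continuous_quotient_mk'.comp
      (((continuous_retraction j).comp hZc).prodMk continuous_const)
  refine hcont.continuousAt.congr ?_
  filter_upwards [hev] with z hz
  obtain ⟨x, hx⟩ := z.2
  obtain ⟨k, hk, hkz⟩ := Quotient.exact hx
  have hact : act (g * k) x.1.1 = (Z z).1 := by
    rw [act_mul, hkz]
    rfl
  have hp := preservesHyperplane_of_close
    (mem_lorentzTwo_and_holonomy (mul_mem hg hk)).1 x.2 hact hz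
  have hZ0 : (Z z).1 j.castSucc = 0 := by rw [← hact, hp]; exact x.2
  rw [show Z z = (⟨Z z, hZ0⟩ : Hyperplane j).1 from rfl, retraction_coe]
  have hq : Quotient.mk (orbitSetoid c) (Z z) = q z.1 :=
    Quotient.sound ((orbitSetoid c).symm ⟨g, hg, rfl⟩)
  exact (hspec _ ⟨Z z, hZ0⟩ hq).symm

theorem exists_det_eq_neg_one {c : Census} {j : Fin 4} (h : ¬ CrossSectionOrientable c j) :
    ∃ g ∈ (crossHom c j).ker, g.1.1.det = -1 := by
  by_contra! h'
  refine h (orientable_of_det_eq_one fun g hg => ?_)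
  have := Int.isUnit_iff.1 ((Matrix.isUnit_iff_isUnit_det _).1 g.1.isUnit)
  exact this.resolve_right (h' g hg)

/-! ### The fundamental group of the orientation cover -/

/-- The determinant, as a homomorphism to the group of signs. -/
def detHom : lorentzTwo 3 →* ℤˣ := Matrix.GeneralLinearGroup.det.comp (lorentzTwo 3).subtype

theorem coe_detHom (g : lorentzTwo 3) : (detHom g : ℤ) = g.1.1.det := rfl

/-- The group of deck transformations of the universal cover of the orientation cover of a
non-orientable cross-section. -/
def deckGroup (c : Census) (j : Fin 4) : Subgroup (lorentzTwo 3) :=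
  (crossHom c j).ker ⊓ detHom.ker

instance (c : Census) (j : Fin 4) : ContinuousConstSMul (deckGroup c j) (Hyp 3) where
  continuous_const_smul g := continuous_const_smul g.1

instance (c : Census) (j : Fin 4) : ProperlyDiscontinuousSMul (deckGroup c j) (Hyp 3) where
  finite_disjoint_inter_image {K L} hK hL :=
    Set.Finite.of_finite_image
      ((ProperlyDiscontinuousSMul.finite_disjoint_inter_image (Γ := lorentzTwo 3) hK hL).subset (by
        rintro _ ⟨g, hg, rfl⟩
        exact hg)) Subtype.val_injective.injOn

instance (c : Census) (j : Fin 4) : IsCancelSMul (deckGroup c j) (Hyp 3) :=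
  isCancelSMul_iff_eq_one_of_smul_eq.2 fun g _ h => Subtype.ext (eq_one_of_smul_eq g.2.1 h)

/-- The universal covering map. -/
def universalCover (c : Census) (j : Fin 4) (x : Hyp 3) : OrientationCover c j :=
  Quotient.mk (orientationSetoid c j) (hyperplaneHomeo j x, 1)

/-- An orientation-reversing element of the kernel identifies the sheet `-1` with the sheet `1`, so
a single copy of hyperbolic three-space already covers everything. -/
theorem isQuotientMap_universalCover {c : Census} {j : Fin 4} (h : ¬ CrossSectionOrientable c j) :
    Topology.IsQuotientMap (universalCover c j) := by
  obtain ⟨g, hg, hdet⟩ := exists_det_eq_neg_one h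
  have hneg : ∀ x, Quotient.mk (orientationSetoid c j) (hyperplaneHomeo j x, -1)
      = universalCover c j (g • x) := fun x =>
    (orientationCover_mk_eq_iff c j _ _ _ _).2 ⟨g, hg, rfl, by rw [hdet]; rfl⟩
  have hcont : Continuous (universalCover c j) :=
    continuous_quotient_mk'.comp ((hyperplaneHomeo j).continuous.prodMk continuous_const)
  refine (Topology.isQuotientMap_iff _).2 ⟨Topology.isCoinducing_iff.2 fun U =>
    ⟨fun hU => ?_, fun hU => hU.preimage hcont⟩, ?_⟩
  · have h1 : Quotient.mk (orientationSetoid c j) ⁻¹' U =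
        (((hyperplaneHomeo j).symm ⁻¹' (universalCover c j ⁻¹' U)) ×ˢ {1}) ∪
        (((hyperplaneHomeo j).symm ⁻¹' ((g • ·) ⁻¹' (universalCover c j ⁻¹' U))) ×ˢ {-1}) := by
      ext ⟨x, u⟩
      obtain ⟨x, rfl⟩ := (hyperplaneHomeo j).surjective x
      rcases Int.units_eq_one_or u with rfl | rfl
      · simp [universalCover]
      · simp [hneg]
    change IsOpen (Quotient.mk (orientationSetoid c j) ⁻¹' U)
    rw [h1]
    exact ((hU.preimage (hyperplaneHomeo j).symm.continuous).prod (isOpen_discrete _)).union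
      (((hU.preimage (continuous_const_smul g)).preimage
        (hyperplaneHomeo j).symm.continuous).prod (isOpen_discrete _))
  · intro y
    obtain ⟨⟨x, u⟩, rfl⟩ := Quotient.exists_rep y
    obtain ⟨x, rfl⟩ := (hyperplaneHomeo j).surjective x
    rcases Int.units_eq_one_or u with rfl | rfl
    · exact ⟨x, rfl⟩
    · exact ⟨_, (hneg x).symm⟩

theorem isQuotientCoveringMap_universalCover {c : Census} {j : Fin 4}
    (h : ¬ CrossSectionOrientable c j) :
    IsQuotientCoveringMap (universalCover c j) (deckGroup c j) := by
  refine (isQuotientMap_universalCover h).isQuotientCoveringMap_of_properlyDiscontinuousSMul ?_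
  intro x y
  rw [eq_comm, universalCover, universalCover, orientationCover_mk_eq_iff]
  constructor
  · rintro ⟨g, hg, hx, hdet⟩
    exact ⟨⟨g, hg, Units.ext (by simpa [coe_detHom] using hdet)⟩, hx⟩
  · rintro ⟨g, hg⟩
    refine ⟨g.1, g.2.1, hg, ?_⟩
    rw [← coe_detHom, MonoidHom.mem_ker.1 g.2.2]
    rfl

/-- The fundamental group of the orientation cover of a non-orientable cross-section is isomorphic
to the group of deck transformations. -/
theorem exists_fundamentalGroup_equiv {c : Census} {j : Fin 4} (h : ¬ CrossSectionOrientable c j)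
    (y : OrientationCover c j) :
    Nonempty (FundamentalGroup (OrientationCover c j) y ≃* deckGroup c j) := by
  have hp := isQuotientCoveringMap_universalCover h
  obtain ⟨x, hx⟩ := hp.surjective y
  -- The covering equivalence lands in the opposite group; inversion corrects this.
  exact ⟨(hp.fundamentalGroupEquiv ⟨x, hx⟩).trans (MulEquiv.inv' _).symm⟩

/-! ### The action of `SL(2, ℤ[i])` on Hermitian forms -/

/-- The action `H ↦ M H Mᴴ` on the Hermitian matrices `H` with diagonal entries `2 a`, `2 d` and
off-diagonal entry `(1 + i) (u + i w)`, in the coordinates `a, d, u, w`. -/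
def hermAct (M : Matrix (Fin 2) (Fin 2) GaussianInt) : Matrix (Fin 4) (Fin 4) ℤ :=
  !![(M 0 0 * star (M 0 0)).re, (M 0 1 * star (M 0 1)).re,
      (⟨1, 1⟩ * (M 0 0 * star (M 0 1))).re, -(⟨1, 1⟩ * (M 0 0 * star (M 0 1))).im;
    (M 1 0 * star (M 1 0)).re, (M 1 1 * star (M 1 1)).re,
      (⟨1, 1⟩ * (M 1 0 * star (M 1 1))).re, -(⟨1, 1⟩ * (M 1 0 * star (M 1 1))).im;
    (⟨1, -1⟩ * (M 0 0 * star (M 1 0))).re, (⟨1, -1⟩ * (M 0 1 * star (M 1 1))).re,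
      (M 0 0 * star (M 1 1) + ⟨0, -1⟩ * (M 0 1 * star (M 1 0))).re,
      -(M 0 0 * star (M 1 1) - ⟨0, -1⟩ * (M 0 1 * star (M 1 0))).im;
    (⟨1, -1⟩ * (M 0 0 * star (M 1 0))).im, (⟨1, -1⟩ * (M 0 1 * star (M 1 1))).im,
      (M 0 0 * star (M 1 1) + ⟨0, -1⟩ * (M 0 1 * star (M 1 0))).im,
      (M 0 0 * star (M 1 1) - ⟨0, -1⟩ * (M 0 1 * star (M 1 0))).re]

theorem hermAct_mul (M N : Matrix (Fin 2) (Fin 2) GaussianInt) :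
    hermAct (M * N) = hermAct M * hermAct N := by
  ext i k
  rw [Matrix.mul_apply, Fin.sum_univ_four]
  fin_cases i <;> fin_cases k <;>
    simp only [hermAct, Matrix.mul_apply,
      Fin.sum_univ_two, Matrix.of_apply, Matrix.cons_val, Fin.zero_eta, Fin.mk_one, Fin.reduceFinMk,
      Zsqrtd.re_mul, Zsqrtd.im_mul, Zsqrtd.re_add, Zsqrtd.im_add, Zsqrtd.re_star, Zsqrtd.im_star,
      Zsqrtd.re_sub, Zsqrtd.im_sub] <;> ring

theorem hermAct_one : hermAct 1 = 1 := by decide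

/-- The Gram matrix of the quadratic form `u ^ 2 + w ^ 2 - 2 a d`. -/
def hermGram : Matrix (Fin 4) (Fin 4) ℤ :=
  !![0, -1, 0, 0; -1, 0, 0, 0; 0, 0, 1, 0; 0, 0, 0, 1]

/-- The determinant of the Hermitian matrix is `-2(u² + w² - 2ad)`, and `M H Mᴴ` multiplies it by
`|det M|²`. -/
theorem transpose_hermAct_mul_hermGram (M : Matrix (Fin 2) (Fin 2) GaussianInt) :
    (hermAct M)ᵀ * hermGram * hermAct M = (M.det * star M.det).re • hermGram := by
  ext i k
  rw [Matrix.mul_apply, Fin.sum_univ_four]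
  simp only [Matrix.mul_apply, Fin.sum_univ_four, Matrix.det_fin_two]
  fin_cases i <;> fin_cases k <;>
    simp only [hermAct, hermGram, Matrix.transpose_apply, Matrix.smul_apply,
      Matrix.of_apply, Matrix.cons_val, Fin.zero_eta, Fin.mk_one, Fin.reduceFinMk,
      Zsqrtd.re_mul, Zsqrtd.im_mul, Zsqrtd.re_add, Zsqrtd.im_add, Zsqrtd.re_star, Zsqrtd.im_star,
      Zsqrtd.re_sub, Zsqrtd.im_sub, smul_eq_mul] <;> ring

/-- The change of coordinates from an orthonormal basis. -/
def hermBasis : Matrix (Fin 4) (Fin 4) ℤ :=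
  !![0, 1, 0, 1; 0, 0, 1, 1; 0, 1, 1, 1; 1, 0, 0, 0]

/-- The inverse of `hermBasis`. -/
def hermBasisInv : Matrix (Fin 4) (Fin 4) ℤ :=
  !![0, 0, 0, 1; 0, -1, 1, 0; -1, 0, 1, 0; 1, 1, -1, 0]

theorem hermBasis_mul_inv : hermBasis * hermBasisInv = 1 := by decide

theorem hermBasisInv_mul : hermBasisInv * hermBasis = 1 := by decide

theorem transpose_hermBasis_mul_hermGram : hermBasisᵀ * hermGram * hermBasis = gram 3 := by decide

/-- The action of a complex matrix on Hermitian forms, in an orthonormal basis. -/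
def theta : Matrix (Fin 2) (Fin 2) GaussianInt →* Matrix (Fin 4) (Fin 4) ℤ where
  toFun M := hermBasisInv * hermAct M * hermBasis
  map_one' := by rw [hermAct_one, Matrix.mul_one, hermBasisInv_mul]
  map_mul' M N := by
    rw [hermAct_mul]
    simp only [Matrix.mul_assoc]
    rw [← Matrix.mul_assoc hermBasis, hermBasis_mul_inv, Matrix.one_mul]

theorem theta_apply (M : Matrix (Fin 2) (Fin 2) GaussianInt) :
    theta M = hermBasisInv * hermAct M * hermBasis := rfl

theorem preservesForm_theta {M : Matrix (Fin 2) (Fin 2) GaussianInt} (hM : M.det = 1) :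
    PreservesForm (n := 3) (theta M) := by
  have h1 := transpose_hermAct_mul_hermGram M
  rw [hM, star_one, mul_one, Zsqrtd.re_one, one_smul] at h1
  have h2 : (hermBasis * hermBasisInv)ᵀ = 1 := by rw [hermBasis_mul_inv, Matrix.transpose_one]
  rw [Matrix.transpose_mul] at h2
  rw [PreservesForm, ← transpose_hermBasis_mul_hermGram, theta_apply, Matrix.transpose_mul,
    Matrix.transpose_mul]
  conv_rhs => rw [← h1]
  simp only [Matrix.mul_assoc]
  rw [← Matrix.mul_assoc hermBasis hermBasisInv, hermBasis_mul_inv, Matrix.one_mul,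
    ← Matrix.mul_assoc hermBasisInvᵀ hermBasisᵀ, h2, Matrix.one_mul]

theorem theta_last_pos {M : Matrix (Fin 2) (Fin 2) GaussianInt} (hM : M.det = 1) :
    0 < theta M 3 3 := by
  have h1 := sum_last_col_sq (preservesForm_theta hM)
  have h0 : theta M 3 3 ≠ 0 := by
    intro h0
    change _ = theta M 3 3 ^ 2 - 1 at h1
    rw [h0] at h1
    have := Finset.sum_nonneg fun (l : Fin 3) (_ : l ∈ Finset.univ) =>
      sq_nonneg (theta M l.castSucc (Fin.last 3))
    rw [h1] at this
    norm_num at this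
  refine lt_of_le_of_ne ?_ h0.symm
  generalize hp0 : (M 0 0).re = p0
  generalize hp1 : (M 0 0).im = p1
  generalize hq0 : (M 0 1).re = q0
  generalize hq1 : (M 0 1).im = q1
  generalize hr0 : (M 1 0).re = r0
  generalize hr1 : (M 1 0).im = r1
  generalize hs0 : (M 1 1).re = s0
  generalize hs1 : (M 1 1).im = s1
  -- The last basis vector is the positive definite Hermitian matrix with diagonal `2, 2` and
  -- off-diagonal entry `1 + i`. The corner entry is therefore a positive definite quadratic form in
  -- `M`; the right side completes its squares.
  have h2 : 8 * theta M 3 3 = 2 * (2 * p0 + q0 + q1 - r0 + r1 - s0) ^ 2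
      + 2 * (2 * p1 - q0 + q1 - r0 - r1 - s1) ^ 2 + (2 * q0 - s0 + s1) ^ 2 + (2 * q1 - s0 - s1) ^ 2
      + (2 * r0 + s0 + s1) ^ 2 + (2 * r1 - s0 + s1) ^ 2 + 2 * s0 ^ 2 + 2 * s1 ^ 2 := by
    rw [theta_apply, Matrix.mul_apply, Fin.sum_univ_four]
    simp only [Matrix.mul_apply, Fin.sum_univ_four]
    simp [hermAct, hermBasis, hermBasisInv, hp0, hp1, hq0, hq1, hr0, hr1, hs0, hs1]
    ring
  have h3 : 0 ≤ 8 * theta M 3 3 := by rw [h2]; positivity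
  linarith

/-! ### The congruence subgroup of level `1 + i` -/

/-- Reduction of Gaussian integers modulo `1 + i`. -/
def parity : GaussianInt →+* ZMod 2 := Zsqrtd.lift ⟨1, rfl⟩

theorem parity_apply (z : GaussianInt) : parity z = z.re + z.im := by
  simp [parity, Zsqrtd.lift]

theorem ker_parity : RingHom.ker parity = Ideal.span {(⟨1, 1⟩ : GaussianInt)} := by
  ext z
  rw [RingHom.mem_ker, Ideal.mem_span_singleton, parity_apply]
  constructor
  · intro h
    have h1 : ((z.re + z.im : ℤ) : ZMod 2) = 0 := by exact_mod_cast h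
    obtain ⟨k, hk⟩ := (ZMod.intCast_zmod_eq_zero_iff_dvd _ 2).1 h1
    refine ⟨⟨k, k - z.re⟩, ?_⟩
    have h2 : ((2 : ℕ) : ℤ) = 2 := rfl
    rw [h2] at hk
    ext
    · simp
    · simp
      linarith
  · rintro ⟨w, rfl⟩
    rw [← parity_apply, map_mul, parity_apply]
    rw [show (((⟨1, 1⟩ : GaussianInt).re : ZMod 2)) + ((⟨1, 1⟩ : GaussianInt).im : ZMod 2) = 0
      from by decide, zero_mul]

/-- The group of matrices in `SL(2, ℤ[i])` that are congruent to the identity modulo `1 + i`. -/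
def gammaOne : Subgroup (Matrix.SpecialLinearGroup (Fin 2) GaussianInt) :=
  (Matrix.SpecialLinearGroup.map (n := Fin 2) parity).ker

theorem mem_gammaOne {M : Matrix.SpecialLinearGroup (Fin 2) GaussianInt} :
    M ∈ gammaOne ↔ ∀ i k, parity (M.1 i k) = (1 : Matrix (Fin 2) (Fin 2) (ZMod 2)) i k := by
  rw [gammaOne, MonoidHom.mem_ker, Matrix.SpecialLinearGroup.ext_iff]
  rfl

theorem principalCongruence_eq : principalCongruence ⟨1, 1⟩ = gammaOne.map
    (QuotientGroup.mk' (Subgroup.center (Matrix.SpecialLinearGroup (Fin 2) GaussianInt))) := by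
  rw [principalCongruence]
  congr 1
  ext M
  rw [mem_gammaOne, MonoidHom.mem_ker, Matrix.SpecialLinearGroup.ext_iff]
  refine forall_congr' fun i => forall_congr' fun k => ?_
  have h1 : (1 : Matrix (Fin 2) (Fin 2) (ZMod 2)) i k
      = parity ((1 : Matrix (Fin 2) (Fin 2) GaussianInt) i k) := by
    rw [Matrix.one_apply, Matrix.one_apply]
    split_ifs <;> simp
  have h2 : (1 : Matrix (Fin 2) (Fin 2) (GaussianInt ⧸ Ideal.span {(⟨1, 1⟩ : GaussianInt)})) i k
      = Ideal.Quotient.mk _ ((1 : Matrix (Fin 2) (Fin 2) GaussianInt) i k) := by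
    rw [Matrix.one_apply, Matrix.one_apply]
    split_ifs <;> simp
  change Ideal.Quotient.mk (Ideal.span {(⟨1, 1⟩ : GaussianInt)}) (M.1 i k) =
    (1 : Matrix (Fin 2) (Fin 2) (GaussianInt ⧸ Ideal.span {(⟨1, 1⟩ : GaussianInt)})) i k ↔ _
  rw [h1, h2, Ideal.Quotient.eq, ← ker_parity, RingHom.mem_ker, map_sub, sub_eq_zero]

/-- The conditions on a matrix in `SL(2, ℤ[i])` to be congruent to the identity modulo `1 + i`. -/
theorem parity_conditions {M : Matrix.SpecialLinearGroup (Fin 2) GaussianInt}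
    (hM : M ∈ gammaOne) :
    ((M.1 0 0).re : ZMod 2) + (M.1 0 0).im = 1 ∧ ((M.1 0 1).re : ZMod 2) + (M.1 0 1).im = 0 ∧
    ((M.1 1 0).re : ZMod 2) + (M.1 1 0).im = 0 ∧ ((M.1 1 1).re : ZMod 2) + (M.1 1 1).im = 1 ∧
    ((M.1 0 0).re : ZMod 2) * (M.1 1 1).im + (M.1 0 0).im * (M.1 1 1).re
      = (M.1 0 1).re * (M.1 1 0).im + (M.1 0 1).im * (M.1 1 0).re := by
  rw [mem_gammaOne] at hM
  simp only [parity_apply] at hM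
  -- The last condition is the imaginary part of `det M = 1`; it does not follow from the congruence
  -- modulo `1 + i`.
  refine ⟨hM 0 0, hM 0 1, hM 1 0, hM 1 1, ?_⟩
  have h1 := congrArg Zsqrtd.im M.2
  rw [Matrix.det_fin_two] at h1
  simp only [Zsqrtd.im_sub, Zsqrtd.im_mul, Zsqrtd.im_one] at h1
  have h2 := congrArg (Int.cast : ℤ → ZMod 2) (sub_eq_zero.1 h1)
  push_cast at h2
  exact h2

theorem two_dvd_one_sub_hermAct {M : Matrix.SpecialLinearGroup (Fin 2) GaussianInt}
    (hM : M ∈ gammaOne) (i k : Fin 4) : (2 : ℤ) ∣ (1 - hermAct M.1) i k := by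
  refine (ZMod.intCast_zmod_eq_zero_iff_dvd _ 2).1 ?_
  have hc := parity_conditions hM
  rw [Matrix.sub_apply]
  fin_cases i <;> fin_cases k <;>
    simp only [hermAct, Matrix.of_apply, Matrix.cons_val, Fin.zero_eta, Fin.mk_one,
      Fin.reduceFinMk, Zsqrtd.re_mul, Zsqrtd.im_mul, Zsqrtd.re_add, Zsqrtd.im_add, Zsqrtd.re_star,
      Zsqrtd.im_star, Zsqrtd.re_sub, Zsqrtd.im_sub, Matrix.one_apply, Fin.isValue, Fin.reduceEq,
      if_true, if_false] <;>
    push_cast <;>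
    generalize ((M.1 0 0).re : ZMod 2) = p0, ((M.1 0 0).im : ZMod 2) = p1,
      ((M.1 0 1).re : ZMod 2) = q0, ((M.1 0 1).im : ZMod 2) = q1,
      ((M.1 1 0).re : ZMod 2) = r0, ((M.1 1 0).im : ZMod 2) = r1,
      ((M.1 1 1).re : ZMod 2) = s0, ((M.1 1 1).im : ZMod 2) = s1 at * <;>
    clear * - hc <;>
    revert p0 p1 q0 q1 r0 r1 s0 s1 <;>
    decide

theorem exists_theta_eq {M : Matrix.SpecialLinearGroup (Fin 2) GaussianInt} (hM : M ∈ gammaOne) :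
    ∃ A : Matrix (Fin 4) (Fin 4) ℤ, theta M.1 = 1 - (2 : ℤ) • A := by
  choose A hA using two_dvd_one_sub_hermAct hM
  have h : hermAct M.1 = 1 - (2 : ℤ) • Matrix.of A := by
    ext i k
    have := hA i k
    rw [Matrix.sub_apply] at this
    rw [Matrix.sub_apply, Matrix.smul_apply, Matrix.of_apply, smul_eq_mul]
    linarith
  refine ⟨hermBasisInv * Matrix.of A * hermBasis, ?_⟩
  rw [theta_apply, h, mul_sub, sub_mul, mul_one, hermBasisInv_mul, mul_smul_comm, smul_mul_assoc]

theorem isLorentzTwo_theta {M : Matrix.SpecialLinearGroup (Fin 2) GaussianInt}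
    (hM : M ∈ gammaOne) : IsLorentzTwo (n := 3) (theta M.1) :=
  ⟨preservesForm_theta M.2, exists_theta_eq hM, theta_last_pos M.2⟩

/-- The action of the congruence subgroup of level `1 + i` on hyperbolic three-space. -/
def thetaHom : gammaOne →* lorentzTwo 3 :=
  (((Units.map theta).comp Matrix.SpecialLinearGroup.toGL).comp gammaOne.subtype).codRestrict
    (lorentzTwo 3) fun M => isLorentzTwo_theta M.2

theorem coe_thetaHom (M : gammaOne) : (thetaHom M).1.1 = theta M.1.1 := rfl

/-! ### The kernel -/

theorem hermAct_eq_one_of_theta_eq_one {M : Matrix (Fin 2) (Fin 2) GaussianInt}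
    (h : theta M = 1) : hermAct M = 1 := by
  have h1 : hermBasis * theta M * hermBasisInv = 1 := by
    rw [h, Matrix.mul_one, hermBasis_mul_inv]
  rw [theta_apply] at h1
  simp only [Matrix.mul_assoc] at h1
  rwa [hermBasis_mul_inv, Matrix.mul_one, ← Matrix.mul_assoc, hermBasis_mul_inv,
    Matrix.one_mul] at h1

theorem re_mul_star_eq_zero {z : GaussianInt} (h : (z * star z).re = 0) : z = 0 := by
  simp only [Zsqrtd.re_mul, Zsqrtd.re_star, Zsqrtd.im_star] at h
  have h1 : z.re ^ 2 + z.im ^ 2 = 0 := by linarith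
  have h2 : z.re = 0 := by nlinarith [sq_nonneg z.re, sq_nonneg z.im]
  have h3 : z.im = 0 := by nlinarith [sq_nonneg z.re, sq_nonneg z.im]
  exact Zsqrtd.ext h2 h3

/-- Two zero norms make `M` diagonal, say with entries `p, s`. Then `p s̄ = 1 = p s` makes `s` real,
and its norm is one. -/
theorem eq_one_or_neg_one_of_theta_eq_one {M : Matrix.SpecialLinearGroup (Fin 2) GaussianInt}
    (h : theta M.1 = 1) : M = 1 ∨ M = -1 := by
  have h1 := hermAct_eq_one_of_theta_eq_one h
  have e := fun i k => congrFun (congrFun h1 i) k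
  have hq : M.1 0 1 = 0 := re_mul_star_eq_zero (e 0 1)
  have hr : M.1 1 0 = 0 := re_mul_star_eq_zero (e 1 0)
  have hx := e 2 2
  have hy := e 3 2
  simp only [hermAct, Matrix.of_apply, Matrix.cons_val, hq, hr, star_zero, mul_zero, add_zero]
    at hx hy
  have hps : M.1 0 0 * star (M.1 1 1) = 1 := Zsqrtd.ext hx hy
  have hdet := M.2
  rw [Matrix.det_fin_two, hq, zero_mul, sub_zero] at hdet
  have hs : star (M.1 1 1) = M.1 1 1 := by
    have hp : M.1 0 0 ≠ 0 := fun h0 => by simp [h0] at hps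
    exact mul_left_cancel₀ hp (hps.trans hdet.symm)
  have hs1 : (M.1 1 1).im = 0 := by
    have := congrArg Zsqrtd.im hs
    rw [Zsqrtd.im_star] at this
    omega
  have hn := e 1 1
  simp only [hermAct, Matrix.of_apply, Matrix.cons_val, hs] at hn
  have hn' : (M.1 1 1).re * (M.1 1 1).re = 1 := by
    rw [Zsqrtd.re_mul, hs1] at hn
    simpa using hn
  rcases Int.isUnit_iff.1 (IsUnit.of_mul_eq_one _ hn') with h0 | h0
  · left
    have hs' : M.1 1 1 = 1 := Zsqrtd.ext h0 hs1
    rw [hs', mul_one] at hdet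
    refine Subtype.ext (Matrix.ext fun i k => ?_)
    fin_cases i <;> fin_cases k
    exacts [hdet, hq, hr, hs']
  · right
    have hs' : M.1 1 1 = -1 := Zsqrtd.ext h0 hs1
    rw [hs', mul_neg, mul_one] at hdet
    have hp' : M.1 0 0 = -1 := neg_eq_iff_eq_neg.1 hdet
    refine Subtype.ext (Matrix.ext fun i k => ?_)
    rw [Matrix.SpecialLinearGroup.coe_neg]
    fin_cases i <;> fin_cases k
    exacts [hp', hq.trans neg_zero.symm, hr.trans neg_zero.symm, hs']

theorem eq_one_or_neg_one_of_mem_center {M : Matrix.SpecialLinearGroup (Fin 2) GaussianInt}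
    (h : M ∈ Subgroup.center (Matrix.SpecialLinearGroup (Fin 2) GaussianInt)) :
    M = 1 ∨ M = -1 := by
  obtain ⟨r, hr, hM⟩ := Matrix.SpecialLinearGroup.mem_center_iff.1 h
  rw [Fintype.card_fin, sq_eq_one_iff] at hr
  rcases hr with rfl | rfl
  · left
    exact Subtype.ext (hM.symm.trans (by simp))
  · right
    exact Subtype.ext (hM.symm.trans (by rw [map_neg, map_one]; rfl))

theorem mem_center_of_eq_one_or_neg_one {M : Matrix.SpecialLinearGroup (Fin 2) GaussianInt}
    (h : M = 1 ∨ M = -1) : M ∈ Subgroup.center (Matrix.SpecialLinearGroup (Fin 2) GaussianInt) := by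
  rcases h with rfl | rfl
  · exact one_mem _
  · exact Subgroup.mem_center_iff.2 fun N => by simp

theorem center_le_gammaOne :
    Subgroup.center (Matrix.SpecialLinearGroup (Fin 2) GaussianInt) ≤ gammaOne := by
  intro M hM
  rcases eq_one_or_neg_one_of_mem_center hM with rfl | rfl
  · exact one_mem _
  · refine mem_gammaOne.2 fun i k => ?_
    rw [parity_apply, Matrix.SpecialLinearGroup.coe_neg]
    fin_cases i <;> fin_cases k <;> rfl

theorem thetaHom_eq_one_iff (M : gammaOne) : thetaHom M = 1 ↔
    M.1 ∈ Subgroup.center (Matrix.SpecialLinearGroup (Fin 2) GaussianInt) := by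
  have h1 : thetaHom M = 1 ↔ theta M.1.1 = 1 := by
    rw [Subtype.ext_iff, Units.ext_iff]
    rfl
  rw [h1]
  refine ⟨fun h => mem_center_of_eq_one_or_neg_one (eq_one_or_neg_one_of_theta_eq_one h),
    fun h => ?_⟩
  rcases eq_one_or_neg_one_of_mem_center h with h | h
  · rw [h]
    exact map_one theta
  · rw [h]
    decide

/-! ### The image -/

/-- Both sides are multiplicative, and a reflection has determinant `-1` and trace of `A` odd. -/
theorem det_eq_ite_trace (g : lorentzTwo 3) :
    g.1.1.det = if (half g.1.1).trace = 0 then 1 else -1 := by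
  induction g using lorentzTwo_induction with
  | one =>
    rw [show ((1 : lorentzTwo 3)).1.1 = 1 from rfl, half_one]
    simp
  | mul i g ih =>
    have hd : (wallRefl i).1.1.det = -1 := by
      rw [coe_wallRefl]
      revert i
      decide
    have ht : (half (wallRefl i).1.1).trace = 1 := by
      rw [half_wallRefl]
      revert i
      decide
    rw [Subgroup.coe_mul, Units.val_mul,
      half_mul (isLorentzTwo (wallRefl i).2).congr (isLorentzTwo g.2).congr, Matrix.trace_add, ht,
      Matrix.det_mul, ih, hd]
    generalize (half g.1.1).trace = t
    revert t
    decide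

/-- The action `H ↦ M H Mᴴ` is `M` tensored with its conjugate, so its trace is `|tr M|²`. -/
theorem trace_theta (M : Matrix (Fin 2) (Fin 2) GaussianInt) : (theta M).trace
    = ((M 0 0).re + (M 1 1).re) ^ 2 + ((M 0 0).im + (M 1 1).im) ^ 2 := by
  rw [theta_apply, Matrix.trace_mul_comm, ← Matrix.mul_assoc, hermBasis_mul_inv, Matrix.one_mul,
    Matrix.trace, Fin.sum_univ_four]
  simp only [hermAct, Matrix.diag_apply, Matrix.of_apply, Matrix.cons_val, Zsqrtd.re_mul,
    Zsqrtd.im_mul, Zsqrtd.re_add, Zsqrtd.re_star, Zsqrtd.im_star, Zsqrtd.re_sub]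
  ring

/-- Modulo two, the congruence and `det M = 1` make `tr M` vanish. Hence `4 - 2 tr A = |tr M|²` is
divisible by four and `tr A` is even. -/
theorem detHom_thetaHom (M : gammaOne) : detHom (thetaHom M) = 1 := by
  refine Units.ext ?_
  rw [coe_detHom, det_eq_ite_trace, if_pos]
  · rfl
  obtain ⟨A, hA⟩ := exists_theta_eq M.2
  rw [coe_thetaHom, half_eq hA]
  have h1 : 2 ∣ (M.1.1 0 0).re + (M.1.1 1 1).re ∧ 2 ∣ (M.1.1 0 0).im + (M.1.1 1 1).im := by
    have hc := parity_conditions M.2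
    have key : ∀ p0 p1 q0 q1 r0 r1 s0 s1 : ZMod 2, p0 + p1 = 1 ∧ q0 + q1 = 0 ∧ r0 + r1 = 0 ∧
        s0 + s1 = 1 ∧ p0 * s1 + p1 * s0 = q0 * r1 + q1 * r0 → p0 + s0 = 0 ∧ p1 + s1 = 0 := by
      decide
    obtain ⟨h1, h2⟩ := key _ _ _ _ _ _ _ _ hc
    constructor
    · exact (ZMod.intCast_zmod_eq_zero_iff_dvd _ 2).1 (by push_cast; exact h1)
    · exact (ZMod.intCast_zmod_eq_zero_iff_dvd _ 2).1 (by push_cast; exact h2)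
  obtain ⟨⟨k, hk⟩, l, hl⟩ := h1
  have h2 := trace_theta M.1.1
  rw [hA, hk, hl, Matrix.trace_sub, Matrix.trace_one, Matrix.trace_smul, smul_eq_mul,
    Fintype.card_fin] at h2
  have h3 : A.trace = 2 * (1 - k ^ 2 - l ^ 2) := by
    push_cast at h2
    linarith
  have h4 : (A.map (Int.cast : ℤ → ZMod 2)).trace = ((A.trace : ℤ) : ZMod 2) := by
    simp [Matrix.trace]
  rw [h4, h3]
  push_cast
  rw [show (2 : ZMod 2) = 0 from rfl, zero_mul]

/-- Matrices in `SL(2, ℤ[i])` whose actions are the products of the six reflections in the walls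
with the first of these reflections. -/
def wallMatrix : Fin 6 → Matrix (Fin 2) (Fin 2) GaussianInt :=
  ![1, !![⟨0, -1⟩, ⟨-1, 1⟩; 0, ⟨0, 1⟩], !![⟨0, -1⟩, 0; ⟨-1, -1⟩, ⟨0, 1⟩],
    !![⟨-1, 2⟩, ⟨2, -2⟩; ⟨1, 1⟩, ⟨-1, -2⟩], !![⟨-1, 2⟩, ⟨1, -1⟩; ⟨2, 2⟩, ⟨-1, -2⟩],
    !![⟨0, -3⟩, ⟨-2, 2⟩; ⟨-2, -2⟩, ⟨0, 3⟩]]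

theorem exists_thetaHom_eq_wallRefl_mul (i : Fin 6) :
    ∃ N : gammaOne, thetaHom N = wallRefl i * wallRefl 0 := by
  have hdet : (wallMatrix i).det = 1 := by
    rw [Matrix.det_fin_two]
    revert i
    decide
  have hpar : ∀ a b, parity (wallMatrix i a b) = (1 : Matrix (Fin 2) (Fin 2) (ZMod 2)) a b := by
    intro a b
    rw [parity_apply]
    clear hdet
    fin_cases i <;> fin_cases a <;> fin_cases b <;> rfl
  let N : Matrix.SpecialLinearGroup (Fin 2) GaussianInt := ⟨wallMatrix i, hdet⟩
  have hN : N ∈ gammaOne := mem_gammaOne.2 hpar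
  refine ⟨⟨N, hN⟩, Subtype.ext (Units.ext ?_)⟩
  · change theta (wallMatrix i) = _
    rw [Subgroup.coe_mul, Units.val_mul, coe_wallRefl, coe_wallRefl]
    clear hN hpar N hdet
    revert i
    decide

/-- The image contains every `r_i r_0`, hence also `r_0 r_i`, so multiplying by a reflection
interchanges the two cosets. -/
theorem exists_thetaHom_eq (g : lorentzTwo 3) :
    ∃ M : gammaOne, g = thetaHom M ∨ g = wallRefl 0 * thetaHom M := by
  induction g using lorentzTwo_induction with
  | one => exact ⟨1, Or.inl (map_one _).symm⟩
  | mul i g ih =>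
    obtain ⟨N, hN⟩ := exists_thetaHom_eq_wallRefl_mul i
    obtain ⟨M, rfl | rfl⟩ := ih
    · have hN' : thetaHom N⁻¹ = wallRefl 0 * wallRefl i := by
        rw [map_inv, hN, mul_inv_rev, inv_eq_of_mul_eq_one_left (wallRefl_mul_self i),
          inv_eq_of_mul_eq_one_left (wallRefl_mul_self 0)]
      refine ⟨N⁻¹ * M, Or.inr ?_⟩
      rw [map_mul, hN', ← mul_assoc, ← mul_assoc, wallRefl_mul_self, one_mul]
    · refine ⟨N * M, Or.inl ?_⟩
      rw [map_mul, hN, mul_assoc]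

theorem range_thetaHom : thetaHom.range = detHom.ker := by
  ext g
  rw [MonoidHom.mem_range, MonoidHom.mem_ker]
  constructor
  · rintro ⟨M, rfl⟩
    exact detHom_thetaHom M
  · intro hg
    obtain ⟨M, rfl | rfl⟩ := exists_thetaHom_eq g
    · exact ⟨M, rfl⟩
    · rw [map_mul, detHom_thetaHom, mul_one] at hg
      have : (detHom (wallRefl 0) : ℤ) = -1 := by
        rw [coe_detHom, coe_wallRefl]
        decide
      rw [hg] at this
      exact absurd this (by decide)

/-! ### Indices -/

theorem map_parity_surjective :
    Function.Surjective (Matrix.SpecialLinearGroup.map (n := Fin 2) parity) := by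
  intro N
  let s : ZMod 2 → GaussianInt := fun x => if x = 0 then 0 else 1
  -- With entries lifted to `0` and `1`, either `ad = 1` and `bc = 0`, or `ad = 0` and `bc = 1`; in
  -- the second case the sign of `b` must be changed to get determinant `1`.
  let A : Matrix (Fin 2) (Fin 2) GaussianInt :=
    !![s (N.1 0 0), if N.1 0 0 * N.1 1 1 = 1 then s (N.1 0 1) else -s (N.1 0 1);
      s (N.1 1 0), s (N.1 1 1)]
  have hs : ∀ x, parity (s x) = x := by
    intro x
    rw [parity_apply]
    revert x
    decide
  have hdet : A.det = 1 := by
    have h := N.2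
    rw [Matrix.det_fin_two] at h ⊢
    have key : ∀ a b c d : ZMod 2, a * d - b * c = 1 →
        s a * s d - (if a * d = 1 then s b else -s b) * s c = 1 := by
      decide
    exact key _ _ _ _ h
  have hA : ∀ i k, parity (A i k) = N.1 i k := by
    intro i k
    fin_cases i <;> fin_cases k
    · exact hs _
    · change parity (if N.1 0 0 * N.1 1 1 = 1 then s (N.1 0 1) else -s (N.1 0 1)) = N.1 0 1
      split_ifs
      · exact hs _
      · rw [map_neg, hs, ZMod.neg_eq_self_mod_two]
    · exact hs _
    · exact hs _
  exact ⟨⟨A, hdet⟩, Subtype.ext (Matrix.ext hA)⟩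

theorem index_gammaOne : gammaOne.index = 6 := by
  rw [gammaOne, Subgroup.index_ker, MonoidHom.range_eq_top.2 map_parity_surjective,
    Subgroup.card_top]
  change Nat.card {A : Matrix (Fin 2) (Fin 2) (ZMod 2) // A.det = 1} = 6
  simp only [Matrix.det_fin_two]
  rw [Nat.card_eq_fintype_card]
  decide +kernel

theorem crossHom_wallRefl (c : Census) (j : Fin 4) (i : Fin 3) (m : {m : Fin 4 // m ≠ j}) :
    (crossHom c j (wallRefl (Fin.castAdd 3 i))).toAdd m = if m = j.succAbove i then 1 else 0 := by
  have h : ∀ m : Fin 4, holonomy c (block j ((wallProj (Fin.castAdd 3 i)).map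
      (Int.cast : ℤ → ZMod 2)) 0) m = if m = j.succAbove i then 1 else 0 := by
    clear m
    intro m
    rw [holonomy_apply]
    cases c <;> revert m i j <;> decide
  change holonomy c (block j (half (wallRefl (Fin.castAdd 3 i)).1.1) 0) m = _
  rw [half_wallRefl, h]

theorem crossHom_surjective (c : Census) (j : Fin 4) : Function.Surjective (crossHom c j) := by
  intro k
  let s : Fin 3 → lorentzTwo 3 := fun i =>
    if k.toAdd ⟨j.succAbove i, Fin.succAbove_ne j i⟩ = 0 then 1 else wallRefl (Fin.castAdd 3 i)
  have hs : ∀ i m, (crossHom c j (s i)).toAdd m = if m.1 = j.succAbove i then k.toAdd m else 0 := by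
    intro i m
    by_cases h : k.toAdd ⟨j.succAbove i, Fin.succAbove_ne j i⟩ = 0
    · rw [show s i = 1 from if_pos h, map_one]
      split_ifs with hm
      · rw [show m = ⟨j.succAbove i, Fin.succAbove_ne j i⟩ from Subtype.ext hm, h]
        rfl
      · rfl
    · rw [show s i = _ from if_neg h, crossHom_wallRefl]
      split_ifs with hm
      · have h1 : m = ⟨j.succAbove i, Fin.succAbove_ne j i⟩ := Subtype.ext hm
        rw [h1]
        exact ((by decide : ∀ x : ZMod 2, x ≠ 0 → x = 1) _ h).symm
      · rfl
  refine ⟨s 0 * s 1 * s 2, Multiplicative.toAdd.injective (funext fun m => ?_)⟩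
  rw [map_mul (crossHom c j), map_mul (crossHom c j), toAdd_mul, toAdd_mul,
    Pi.add_apply, Pi.add_apply, hs, hs, hs]
  obtain ⟨i, hi⟩ := Fin.exists_succAbove_eq m.2
  rw [← hi]
  simp only [Fin.succAbove_right_inj]
  fin_cases i <;> simp

/-- The image of `thetaHom` is only the orientation-preserving half. A preimage with determinant
`-1` is corrected by an orientation-reversing element of the kernel, which is where
non-orientability enters the index. -/
theorem crossHom_comp_thetaHom_surjective {c : Census} {j : Fin 4}
    (h : ¬ CrossSectionOrientable c j) :
    Function.Surjective ((crossHom c j).comp thetaHom) := by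
  intro k
  obtain ⟨g, hg⟩ := crossHom_surjective c j k
  obtain ⟨r, hr, hdet⟩ := exists_det_eq_neg_one h
  obtain ⟨g', hg', hd⟩ : ∃ g', crossHom c j g' = k ∧ detHom g' = 1 := by
    rcases Int.units_eq_one_or (detHom g) with hd | hd
    · exact ⟨g, hg, hd⟩
    · refine ⟨g * r, by rw [map_mul, hg, MonoidHom.mem_ker.1 hr, mul_one], ?_⟩
      rw [map_mul, hd, show detHom r = -1 from Units.ext hdet]
      rfl
  obtain ⟨M, rfl⟩ : g' ∈ thetaHom.range := by rwa [range_thetaHom]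
  exact ⟨M, hg'⟩

theorem index_ker_crossHom_comp_thetaHom {c : Census} {j : Fin 4}
    (h : ¬ CrossSectionOrientable c j) : ((crossHom c j).comp thetaHom).ker.index = 8 := by
  rw [Subgroup.index_ker, MonoidHom.range_eq_top.2 (crossHom_comp_thetaHom_surjective h),
    Subgroup.card_top]
  change Nat.card ({m : Fin 4 // m ≠ j} → ZMod 2) = 8
  rw [Nat.card_eq_fintype_card, Fintype.card_fun, ZMod.card, Fintype.card_subtype_compl]
  simp

/-! ### The image in the Picard group -/

/-- Two homomorphisms with the same kernel induce an injective homomorphism between subgroups of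
their images. -/
theorem exists_hom_of_ker_eq {G A B : Type*} [Group G] [Group A] [Group B] {f : G →* A}
    {g : G →* B} (hk : f.ker = g.ker) {D : Subgroup A} (hD : D ≤ f.range) :
    ∃ σ : D →* B, Function.Injective σ ∧ σ.range = (D.comap f).map g := by
  let τ : f.range →* B := f.rangeRestrict.liftOfSurjective f.rangeRestrict_surjective
    ⟨g, by rw [f.ker_rangeRestrict, hk]⟩
  have hτ : ∀ x, τ (f.rangeRestrict x) = g x := fun x =>
    MonoidHom.liftOfRightInverse_comp_apply _ _ _ _ x
  refine ⟨τ.comp (Subgroup.inclusion hD), ?_, ?_⟩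
  · refine Function.Injective.comp (g := τ) ?_ (Subgroup.inclusion_injective hD)
    rw [injective_iff_map_eq_one]
    intro a ha
    obtain ⟨x, rfl⟩ := f.rangeRestrict_surjective a
    rw [hτ, ← MonoidHom.mem_ker, ← hk] at ha
    exact Subtype.ext ha
  · ext b
    constructor
    · rintro ⟨⟨a, ha⟩, rfl⟩
      obtain ⟨x, rfl⟩ := hD ha
      exact ⟨x, ha, (hτ x).symm⟩
    · rintro ⟨x, hx, rfl⟩
      exact ⟨⟨f x, hx⟩, hτ x⟩

/-- The projection of the congruence subgroup to the Picard group. -/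
def toPicard : gammaOne →* Picard :=
  (QuotientGroup.mk' (Subgroup.center (Matrix.SpecialLinearGroup (Fin 2) GaussianInt))).comp
    gammaOne.subtype

theorem ker_toPicard : thetaHom.ker = toPicard.ker := by
  ext M
  rw [MonoidHom.mem_ker, thetaHom_eq_one_iff, MonoidHom.mem_ker]
  exact (QuotientGroup.eq_one_iff _).symm

theorem principalCongruence_eq_range : principalCongruence ⟨1, 1⟩ = toPicard.range := by
  rw [principalCongruence_eq, toPicard, MonoidHom.range_comp, Subgroup.range_subtype]

theorem normal_principalCongruence : (principalCongruence ⟨1, 1⟩).Normal :=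
  Subgroup.Normal.map (MonoidHom.normal_ker _) _ (QuotientGroup.mk'_surjective _)

theorem index_map_toPicard {K : Subgroup gammaOne} (hK : toPicard.ker ≤ K) :
    (K.map toPicard).index = K.index * gammaOne.index := by
  rw [toPicard, ← Subgroup.map_map, Subgroup.index_map_eq _ (QuotientGroup.mk'_surjective _),
    Subgroup.index_map_subtype]
  rw [QuotientGroup.ker_mk']
  intro M hM
  exact ⟨⟨M, center_le_gammaOne hM⟩, hK ((QuotientGroup.eq_one_iff _).2 hM), rfl⟩

theorem comap_deckGroup (c : Census) (j : Fin 4) :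
    (deckGroup c j).comap thetaHom = ((crossHom c j).comp thetaHom).ker := by
  ext M
  exact and_iff_left (detHom_thetaHom M)

end CongruenceTwo

theorem proposition3p1 (c : CongruenceTwo.Census) (j : Fin 4)
    (hY : ¬ CongruenceTwo.CrossSectionOrientable c j)
    (y : CongruenceTwo.OrientationCover c j) :
    ∃ ρ : FundamentalGroup (CongruenceTwo.OrientationCover c j) y →* CongruenceTwo.Picard,
      Function.Injective ρ ∧
      ρ.range.index = 48 ∧
      ρ.range ≤ CongruenceTwo.principalCongruence ⟨1, 1⟩ ∧
      (ρ.range.subgroupOf (CongruenceTwo.principalCongruence ⟨1, 1⟩)).Normal ∧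
      ⁅CongruenceTwo.principalCongruence ⟨1, 1⟩, CongruenceTwo.principalCongruence ⟨1, 1⟩⁆
        ≤ ρ.range ∧
      (⁅CongruenceTwo.principalCongruence ⟨1, 1⟩,
        CongruenceTwo.principalCongruence ⟨1, 1⟩⁆.subgroupOf ρ.range).Normal := by
  open CongruenceTwo in
  obtain ⟨e⟩ := exists_fundamentalGroup_equiv hY y
  obtain ⟨σ, hσ, hr⟩ := exists_hom_of_ker_eq ker_toPicard (D := deckGroup c j)
    (inf_le_right.trans range_thetaHom.ge)
  rw [comap_deckGroup] at hr
  have hn := normal_principalCongruence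
  have hcomm : ⁅principalCongruence ⟨1, 1⟩, principalCongruence ⟨1, 1⟩⁆ ≤ σ.range := by
    rw [hr, principalCongruence_eq_range, MonoidHom.range_eq_map, ← Subgroup.map_commutator]
    refine Subgroup.map_mono ?_
    -- The target of `crossHom` is abelian.
    exact Abelianization.commutator_subset_ker ((crossHom c j).comp thetaHom)
  have hle : σ.range ≤ principalCongruence ⟨1, 1⟩ := by
    rw [hr, principalCongruence_eq_range, MonoidHom.range_eq_map]
    exact Subgroup.map_mono le_top
  have hρ : (σ.comp e.toMonoidHom).range = σ.range := by
    rw [MonoidHom.range_comp, MonoidHom.range_eq_top.2 e.surjective, ← MonoidHom.range_eq_map]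
  refine ⟨σ.comp e.toMonoidHom, hσ.comp e.injective, ?_⟩
  rw [hρ]
  refine ⟨?_, hle, ?_, hcomm, inferInstance⟩
  · rw [hr, index_map_toPicard, index_ker_crossHom_comp_thetaHom hY, index_gammaOne]
    rw [← ker_toPicard]
    intro M hM
    rw [MonoidHom.mem_ker, MonoidHom.comp_apply, MonoidHom.mem_ker.1 hM, map_one]
  · refine ⟨fun n hm g => ?_⟩
    -- A subgroup containing all commutators is normal: `g n g⁻¹ = ⁅g, n⁆ n`.
    have h1 : ⁅g.1, n.1⁆ * n.1 ∈ σ.range :=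
      mul_mem (hcomm (Subgroup.commutator_mem_commutator g.2 n.2)) hm
    rwa [commutatorElement_def, inv_mul_cancel_right] at h1
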